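/- **Setting.** Let $\Bbbk$ be a field of characteristic $\neq 2$ and let $0<i<n$ be integers. Let $\mathcal C$ be the $\Bbbk$-linear category with objects $T_0,\dots,T_n$ and $\mathrm{Hom}(T_j,T_k)=\bigoplus_{\alpha\ge 0}\Bbbk\,a_{kj}s^{\alpha}$, with composition $$a_{lk}s^{\beta}\cdot a_{kj}s^{\alpha}=a_{lj}s^{\alpha+\beta+\delta},\qquad \delta=\begin{cases}0,&(j-k)(k-l)\ge 0,\\ \min(|j-k|,|k-l|),&(j-k)(k-l)<0,\end{cases}$$ and identities $a_{jj}s^0$. Write $s_j^{\ell}=a_{jj}s^{\ell}$, $q_{i-1}=a_{i-1,i}$, $p_{i+1}=a_{i+1,i}$. Regard $\mathcal C$ as an $A_\infty$-category with all morphisms in degree $0$, $\mu^2(b,a)=ba$ and $\mu^d=0$ for $d\ne 2$. Let $\mathrm{Tw}^b(\mathcal C)$ be the category of bounded twisted complexes $(X,\delta)$ over $\mathcal C$, with $\mu^1(\varphi)=(-1)^{|\varphi|}\delta\varphi-\varphi\delta$, $\mu^2(\psi,\varphi)=(-1)^{|\varphi|}\psi\varphi$ and $\mu^{d}=0$ for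 $d\ge 3$. The *negative braiding functor* $\beta_i^-:\mathcal C\to\mathrm{Tw}^b(\mathcal C)$ is the following $A_\infty$-functor. * $\beta_i^-T_j=T_j$ for $j\ne i$, and $\beta_i^-T_i=\big(T_i\xrightarrow{[\,a_{i-1,i},\,-a_{i+1,i}\,]}T_{i-1}\oplus T_{i+1}\big)$ in degrees $-1,0$. * $(\beta_i^-)^1(a_{kj}s^\alpha)=a_{kj}s^\alpha$ for $j,k\neq i$. $(\beta_i^-)^1(a_{ij}s^\alpha)$ is $a_{i-1,j}s^\alpha$ into $T_{i-1}$ if $j<i$, and $a_{i+1,j}s^\alpha$ into $T_{i+1}$ if $j>i$. $(\beta_i^-)^1(a_{ki}s^\alpha)$ is $[a_{k,i-1}s^\alpha,\ a_{k,i+1}s^{\alpha+1}]$ if $k>i$ and $[a_{k,i-1}s^{\alpha+1},\ a_{k,i+1}s^{\alpha}]$ if $k<i$. $(\beta_i^-)^1(a_{ii}s^\alpha)$ is multiplication by $s^\alpha$ on each of the three summands. * $(\beta_i^-)^2(a_{lk}s^{\beta},a_{kj}s^{\alpha})=0$ if $l\neq i$. If $l=i$ and $j\neq i$, it is $\mathrm{sgn}(i-k)\,a_{ij}s^{\alpha+\beta+|i-k|-1}$,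 into the summand $T_i$ of $\beta_i^-T_i$, when $(i-j)(i-k)<0$, and $0$ otherwise. If $l=j=i$, it is $\mathrm{sgn}(i-k)\,a_{i,i+\mathrm{sgn}(i-k)}s^{\alpha+\beta+|i-k|-1}$, from the summand $T_{i+\mathrm{sgn}(i-k)}$ to the summand $T_i$, when $k\ne i$, and $0$ when $k=i$. * $(\beta_i^-)^d=0$ for $d\ge 3$. Let $\mathrm{id}$ denote the inclusion $\mathcal C\to\mathrm{Tw}^b(\mathcal C)$. A pre-natural transformation $\eta:\mathrm{id}\Rightarrow\beta_i^-$ of degree $g$ consists of multilinear maps $\eta^d$ ($d\ge 0$) of degree $g-d$, from chains of $d$ composable morphisms $T_{j_0}\to\cdots\to T_{j_d}$ to $\mathrm{Hom}(T_{j_0},\beta_i^-T_{j_d})$. These form a complex under the differential $\mu^1$ of the $A_\infty$-category of $A_\infty$-functors. The $A_\infty$-natural transformations are its cocycles, and $\mathrm{HH}^0(\mathfrak B_{i^-})$ is its cohomology in degree $0$. **Theorem.** For every finitely supported sequence $\epsilon=\{\epsilon_\ell\}_{\ell\ge1}\in\Bbbk^{\mathbb Z_{\ge1}}=\bigoplus_{\ell\ge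 1}\Bbbk$ let $\eta_\epsilon$ be the family with $$\eta_\epsilon^0(T_j)=\begin{cases}\sum_{\ell\ge1}\epsilon_\ell\,s_j^{\ell},&j\ne i,\\[2pt] \sum_{\ell\ge1}\epsilon_\ell\big[\tfrac12 q_{i-1}s^{\ell-1},\ \tfrac12 p_{i+1}s^{\ell-1}\big],&j=i,\end{cases}$$ $$\eta_\epsilon^1(a_{kj}s^\alpha)=\begin{cases}0,&k\neq i,\\[2pt] \mathrm{sgn}(i-j)\sum_{\ell\ge1}\tfrac12\epsilon_\ell\,a_{ij}s^{\alpha+\ell-1},&k=i,\end{cases}$$ where the last morphism maps into the degree $-1$ summand $T_i$ of $\beta_i^-T_i$, and $\eta_\epsilon^d=0$ for $d\ge2$. Then: 1. each $\eta_\epsilon$ is an $A_\infty$-natural transformation $\mathrm{id}\Rightarrow\beta_i^-$ of degree $0$, and $\epsilon\mapsto[\eta_\epsilon]$ is an isomorphism of vector spaces $\Bbbk^{\mathbb Z_{\ge1}}\cong\mathrm{HH}^0(\mathfrak B_{i^-})$; that is, every degree-$0$ natural transformation $\mathrm{id}\Rightarrow\beta_i^-$ is cohomologous to exactly one $\eta_\epsilon$;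 2. if $\epsilon\ne0$, then $\eta_\epsilon^1\neq0$. -/

import Mathlib

open CategoryTheory Polynomial

universe v u

namespace Braid

/-! ### Chains of composable morphisms -/

section Chains

variable {C : Type u} [Category.{v} C]

/-- All ways of cutting a chain `(a_d, …, a_1)` of composable morphisms into an initial part
`(a_s, …, a_1)` and a final part `(a_d, …, a_{s+1})`, for `0 ≤ s ≤ d`.  A chain is a
`Quiver.Path`; its first arrow is `a_1`. -/
def splits : ∀ {X Y : C}, Quiver.Path X Y → List (Σ Z : C, Quiver.Path X Z × Quiver.Path Z Y)
  | _, _, .nil => [⟨_, .nil, .nil⟩]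
  | _, _, .cons p f =>
      (splits p).map (fun s => ⟨s.1, s.2.1, s.2.2.cons f⟩) ++ [⟨_, p.cons f, .nil⟩]

/-- All chains `(a_d, …, a_{n+3}, a_{n+2} a_{n+1}, a_n, …, a_1)` obtained from `(a_d, …, a_1)` by
composing two neighbours, each listed with its number `n`, for `0 ≤ n ≤ d - 2`. -/
def contractions : ∀ {X Y : C}, Quiver.Path X Y → List (ℕ × Quiver.Path X Y)
  | _, _, .nil => []
  | _, _, .cons .nil _ => []
  | _, _, .cons (.cons p f) g =>
      (contractions (p.cons f)).map (fun c => (c.1, c.2.cons g)) ++ [(p.length, p.cons (f ≫ g))]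

theorem length_of_mem_splits {X Y : C} (p : Quiver.Path X Y) :
    ∀ s ∈ splits p, s.2.1.length + s.2.2.length = p.length := by
  induction p with
  | nil => intro s hs; simp [splits] at hs; subst hs; rfl
  | cons p f ih =>
    intro s hs
    simp only [splits, List.mem_append, List.mem_map, List.mem_singleton] at hs
    rcases hs with ⟨t, ht, rfl⟩ | rfl
    · have := ih t ht
      simp only [Quiver.Path.length_cons]; omega
    · simp

theorem length_of_mem_contractions {X Y : C} (p : Quiver.Path X Y) :
    ∀ c ∈ contractions p, c.2.length + 1 = p.length := by
  induction p with
  | nil => intro c hc; simp [contractions] at hc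
  | cons p f ih =>
    intro c hc
    cases p with
    | nil => simp [contractions] at hc
    | cons p e =>
      simp only [contractions, List.mem_append, List.mem_map, List.mem_singleton] at hc
      rcases hc with ⟨t, ht, rfl⟩ | rfl
      · have := ih t ht
        simp only [Quiver.Path.length_cons] at this ⊢; omega
      · simp

end Chains

/-! ### Bounded twisted complexes

Let `C` be a linear category, regarded as an `A∞`-category whose morphisms all have degree `0` and
whose only structure map is the composition `μ²`. -/

/-- A bounded twisted complex over `C`: finitely many summands `obj a`, placed in degree `deg a`,
with a bounding cochain `δ` of degree `1` that satisfies the Maurer-Cartan equation `δ ∘ δ = 0`. -/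
structure Tw (C : Type u) [Category.{v} C] [Preadditive C] where
  ι : Type
  [fin : Fintype ι]
  obj : ι → C
  deg : ι → ℤ
  δ : ∀ a b, obj a ⟶ obj b
  δ_deg : ∀ a b, deg b ≠ deg a + 1 → δ a b = 0
  δ_sq : ∀ a c, ∑ b, δ a b ≫ δ b c = 0

attribute [instance] Tw.fin

namespace Tw

variable {C : Type u} [Category.{v} C] [Preadditive C]

/-- The total space of morphisms between twisted complexes: matrices of morphisms of `C`. The entry
from the summand `a` to the summand `b` has degree `Y.deg b - X.deg a`. -/
abbrev Hom (X Y : Tw C) : Type v := ∀ (a : X.ι) (b : Y.ι), X.obj a ⟶ Y.obj b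

/-- `φ` is homogeneous of degree `g`. -/
def Hom.HasDeg {X Y : Tw C} (φ : Hom X Y) (g : ℤ) : Prop :=
  ∀ a b, Y.deg b ≠ X.deg a + g → φ a b = 0

/-- The differential `μ¹(φ) = (-1)^{|φ|} δ φ - φ δ` of twisted complexes. -/
def μ₁ {X Y : Tw C} (φ : Hom X Y) : Hom X Y := fun a c =>
  ∑ b, (Y.deg b - X.deg a).negOnePow • (φ a b ≫ Y.δ b c) - ∑ b, X.δ a b ≫ φ b c

/-- The product `μ²(ψ, φ) = (-1)^{|φ|} ψ φ` of twisted complexes. -/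
def μ₂ {X Y Z : Tw C} (ψ : Hom Y Z) (φ : Hom X Y) : Hom X Z := fun a c =>
  ∑ b, (Y.deg b - X.deg a).negOnePow • (φ a b ≫ ψ b c)

/-- An object of `C` as a twisted complex with one summand, in degree `0`. -/
def single (X : C) : Tw C where
  ι := Unit
  obj _ := X
  deg _ := 0
  δ _ _ := 0
  δ_deg _ _ _ := rfl
  δ_sq _ _ := by simp

@[simp] theorem μ₁_zero {X Y : Tw C} : μ₁ (0 : Hom X Y) = 0 := by
  funext a c; simp [μ₁]

@[simp] theorem μ₂_zero_left {X Y Z : Tw C} (φ : Hom X Y) : μ₂ (0 : Hom Y Z) φ = 0 := by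
  funext a c; simp [μ₂]

@[simp] theorem μ₂_zero_right {X Y Z : Tw C} (ψ : Hom Y Z) : μ₂ ψ (0 : Hom X Y) = 0 := by
  funext a c; simp [μ₂]

@[simp] theorem single_δ (X : C) (a b : (single X).ι) : (single X).δ a b = 0 := rfl

@[simp] theorem single_deg (X : C) (a : (single X).ι) : (single X).deg a = 0 := rfl

theorem single_sum {M : Type*} [AddCommMonoid M] (X : C) (f : (single X).ι → M) :
    ∑ a, f a = f () := by
  exact Fintype.sum_unique (ι := Unit) f

theorem μ₁_add {X Y : Tw C} (φ φ' : Hom X Y) : μ₁ (φ + φ') = μ₁ φ + μ₁ φ' := by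
  funext a c
  simp only [μ₁, Pi.add_apply, Preadditive.add_comp, Preadditive.comp_add, smul_add,
    Finset.sum_add_distrib]
  abel

theorem μ₂_add_left {X Y Z : Tw C} (ψ ψ' : Hom Y Z) (φ : Hom X Y) :
    μ₂ (ψ + ψ') φ = μ₂ ψ φ + μ₂ ψ' φ := by
  funext a c
  simp only [μ₂, Pi.add_apply, Preadditive.comp_add, smul_add, Finset.sum_add_distrib]

theorem μ₂_add_right {X Y Z : Tw C} (ψ : Hom Y Z) (φ φ' : Hom X Y) :
    μ₂ ψ (φ + φ') = μ₂ ψ φ + μ₂ ψ φ' := by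
  funext a c
  simp only [μ₂, Pi.add_apply, Preadditive.add_comp, smul_add, Finset.sum_add_distrib]

section

variable {k : Type*} [Field k] [Linear k C]

theorem list_sum_smul {A M : Type*} [AddCommGroup M] [Module k M] (r : k) (l : List A)
    (f : A → M) : (l.map fun x => r • f x).sum = r • (l.map f).sum := by
  induction l with
  | nil => simp
  | cons x l ih => simp [ih, smul_add]

theorem μ₁_smul {X Y : Tw C} (r : k) (φ : Hom X Y) : μ₁ (r • φ) = r • μ₁ φ := by
  funext a c
  simp only [μ₁, Pi.smul_apply, Linear.smul_comp, Linear.comp_smul, smul_sub, Finset.smul_sum,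
    Units.smul_def, smul_comm r]

theorem μ₂_smul_left {X Y Z : Tw C} (r : k) (ψ : Hom Y Z) (φ : Hom X Y) :
    μ₂ (r • ψ) φ = r • μ₂ ψ φ := by
  funext a c
  simp only [μ₂, Pi.smul_apply, Linear.comp_smul, Finset.smul_sum, Units.smul_def, smul_comm r]

theorem μ₂_smul_right {X Y Z : Tw C} (r : k) (ψ : Hom Y Z) (φ : Hom X Y) :
    μ₂ ψ (r • φ) = r • μ₂ ψ φ := by
  funext a c
  simp only [μ₂, Pi.smul_apply, Linear.smul_comp, Finset.smul_sum, Units.smul_def, smul_comm r]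

end

end Tw

/-! ### `A∞`-functors `C → Tw C` and their natural transformations -/

section Functors

variable (k : Type*) [Field k] (C : Type u) [Category.{v} C] [Preadditive C] [Linear k C]

/-- An `A∞`-functor from `C` to its category of bounded twisted complexes. The component `F^d` is
the restriction of `map` to the chains of length `d`; there is no component `F^0`. The equations
are the general ones
`∑ μ^r(F^{i_r}(…), …, F^{i_1}(…)) = ∑ (-1)^{✠_n} F^{d-m+1}(…, μ^m(…), a_n, …, a_1)`,
in which `✠_n = |a_1| + ⋯ + |a_n| - n = -n`, only `μ²` is nonzero in `C`, and only `μ¹` and `μ²` are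
nonzero for twisted complexes. -/
structure AInfFunctor where
  obj : C → Tw C
  map : ∀ {X Y : C}, Quiver.Path X Y → Tw.Hom (obj X) (obj Y)
  map_nil : ∀ X : C, map (Quiver.Path.nil : Quiver.Path X X) = 0
  map_linear : ∀ {X Y Z W : C} (p : Quiver.Path X Y) (q : Quiver.Path Z W),
    IsLinearMap k (fun f : Y ⟶ Z => map ((p.cons f).comp q))
  map_deg : ∀ {X Y : C} (p : Quiver.Path X Y), (map p).HasDeg (1 - p.length)
  map_rel : ∀ {X Y : C} (p : Quiver.Path X Y),
    Tw.μ₁ (map p) + ((splits p).map fun s => Tw.μ₂ (map s.2.2) (map s.2.1)).sum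
      = ((contractions p).map fun c => (-(c.1 : ℤ)).negOnePow • map c.2).sum

variable {k C}

/-- Families of maps that assign to a chain of composable morphisms from `X` to `Y` a morphism
`F X → G Y`. -/
abbrev Family (F G : AInfFunctor k C) : Type _ :=
  ∀ (X Y : C), Quiver.Path X Y → Tw.Hom (F.obj X) (G.obj Y)

/-- Pre-natural transformations of degree `g`: the component `η^d`, the restriction of `η` to the
chains of length `d ≥ 0`, is multilinear and takes values in degree `g - d`. -/
def preNat (F G : AInfFunctor k C) (g : ℤ) : Submodule k (Family F G) where
  carrier := {η |
    (∀ {X Y Z W : C} (p : Quiver.Path X Y) (q : Quiver.Path Z W),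
      IsLinearMap k (fun f : Y ⟶ Z => η X W ((p.cons f).comp q))) ∧
    ∀ {X Y : C} (p : Quiver.Path X Y), (η X Y p).HasDeg (g - p.length)}
  add_mem' := by
    rintro η θ ⟨h1, h2⟩ ⟨h3, h4⟩
    refine ⟨fun {X Y Z W} p q => ⟨fun f f' => ?_, fun c f => ?_⟩, fun p a b hab => ?_⟩
    · have e1 := (h1 p q).map_add f f'
      have e2 := (h3 p q).map_add f f'
      simp only [Pi.add_apply] at e1 e2 ⊢
      rw [e1, e2]; abel
    · have e1 := (h1 p q).map_smul c f
      have e2 := (h3 p q).map_smul c f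
      simp only [Pi.add_apply] at e1 e2 ⊢
      rw [e1, e2, smul_add]
    · simp [h2 p a b hab, h4 p a b hab]
  zero_mem' := ⟨fun p q => ⟨by simp, by simp⟩, fun p a b _ => rfl⟩
  smul_mem' := by
    rintro r η ⟨h1, h2⟩
    refine ⟨fun {X Y Z W} p q => ⟨fun f f' => ?_, fun c f => ?_⟩, fun p a b hab => ?_⟩
    · have e1 := (h1 p q).map_add f f'
      simp only [Pi.smul_apply] at e1 ⊢
      rw [e1, smul_add]
    · have e1 := (h1 p q).map_smul c f
      simp only [Pi.smul_apply] at e1 ⊢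
      rw [e1, smul_comm]
    · simp [h2 p a b hab]

/-- The differential `μ¹` of the functor category on pre-natural transformations of degree `g`,
evaluated on a chain `(a_d, …, a_1)`. In the general formula
`∑ (-1)^† μ^r(G(…), …, G(…), η(…), F(…), …, F(…)) - ∑ (-1)^{✠_n + g - 1} η(…, μ^m(…), a_n, …, a_1)`
one has `† = (g - 1)(-s)`, where `s` is the number of morphisms to the right of `η(…)`. -/
def natDiffFun (F G : AInfFunctor k C) (g : ℤ) (η : Family F G) : Family F G := fun X Y p =>
  Tw.μ₁ (η X Y p)
    + ((splits p).map fun s => Tw.μ₂ (G.map s.2.2) (η X s.1 s.2.1)).sum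
    + ((splits p).map fun s =>
        ((g - 1) * -(s.2.1.length : ℤ)).negOnePow • Tw.μ₂ (η s.1 Y s.2.2) (F.map s.2.1)).sum
    - ((contractions p).map fun c => (-(c.1 : ℤ) + g - 1).negOnePow • η X Y c.2).sum

/-- `natDiffFun` as a linear map. -/
def natDiff (F G : AInfFunctor k C) (g : ℤ) : Family F G →ₗ[k] Family F G where
  toFun := natDiffFun F G g
  map_add' η θ := by
    funext X Y p
    simp only [natDiffFun, Pi.add_apply, Tw.μ₁_add, Tw.μ₂_add_left, Tw.μ₂_add_right, smul_add,
      List.sum_map_add]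
    abel
  map_smul' r η := by
    funext X Y p
    simp only [natDiffFun, Pi.smul_apply, Tw.μ₁_smul, Tw.μ₂_smul_left, Tw.μ₂_smul_right,
      RingHom.id_apply, Units.smul_def, smul_comm _ r, Tw.list_sum_smul,
      smul_add, smul_sub]

/-- The `A∞`-natural transformations `F ⇒ G` of degree `g`: the pre-natural transformations `η` of
degree `g` with `μ¹(η) = 0`. -/
def natTrans (F G : AInfFunctor k C) (g : ℤ) : Submodule k (Family F G) :=
  preNat F G g ⊓ LinearMap.ker (natDiff F G g)

/-- The coboundaries of degree `g`: the differentials of pre-natural transformations of degree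
`g - 1`. -/
def coboundaries (F G : AInfFunctor k C) (g : ℤ) : Submodule k (Family F G) :=
  (preNat F G (g - 1)).map (natDiff F G (g - 1))

/-- The cohomology of the complex of pre-natural transformations `F ⇒ G` in degree `g`. If `F` is
the inclusion of `C` this is the Hochschild cohomology `HH^g(G)`. -/
abbrev HH (F G : AInfFunctor k C) (g : ℤ) : Type _ :=
  natTrans F G g ⧸ (coboundaries F G g).submoduleOf (natTrans F G g)

/-- The components of the inclusion `C → Tw C`. -/
def inclMap : ∀ {X Y : C}, Quiver.Path X Y → Tw.Hom (Tw.single X) (Tw.single Y)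
  | _, _, .nil => 0
  | _, _, .cons .nil f => fun _ _ => f
  | _, _, .cons (.cons _ _) _ => 0

theorem inclMap_eq_zero {X Y : C} (p : Quiver.Path X Y) (h : p.length ≠ 1) : inclMap p = 0 := by
  match p, h with
  | .nil, _ => rfl
  | .cons .nil f, h => simp at h
  | .cons (.cons _ _) _, _ => rfl

variable (k C) in
/-- The inclusion `C → Tw C`, that is, the restriction to `C` of the identity functor of `Tw C`. Its
only component is `F^1(a) = a`. -/
def incl : AInfFunctor k C where
  obj := Tw.single
  map := inclMap
  map_nil _ := rfl
  map_linear {X Y Z W} p q := by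
    by_cases h : ((p.cons (0 : Y ⟶ Z)).comp q).length = 1
    · match p, q with
      | .nil, .nil => exact ⟨fun f g => rfl, fun c f => rfl⟩
      | .cons _ _, _ => simp at h; omega
      | _, .cons _ _ => simp at h
    · have : ∀ f : Y ⟶ Z, inclMap ((p.cons f).comp q) = 0 := fun f =>
        inclMap_eq_zero _ (by simpa using h)
      simp only [this]
      exact ⟨by simp, by simp⟩
  map_deg {X Y} p := by
    match p with
    | .nil => intro a b _; rfl
    | .cons .nil f => intro a b h; simp [Tw.single] at h
    | .cons (.cons _ _) _ => intro a b _; rfl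
  map_rel {X Y} p := by
    have hμ : ∀ {X Y : C} (φ : Tw.Hom (Tw.single X) (Tw.single Y)), Tw.μ₁ φ = 0 := by
      intro X Y φ; funext a c; simp [Tw.μ₁]
    rw [hμ, zero_add]
    match p with
    | .nil => simp [splits, contractions, inclMap]
    | .cons .nil f =>
      have h0 : ∀ Z : C, inclMap (.nil : Quiver.Path Z Z) = 0 := fun _ => rfl
      simp [splits, contractions, h0]
    | .cons (.cons .nil f) g =>
      have h0 : ∀ Z : C, inclMap (.nil : Quiver.Path Z Z) = 0 := fun _ => rfl
      simp only [splits, contractions, h0, List.map_cons, List.map_nil, List.nil_append,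
        List.cons_append, List.sum_cons, List.sum_nil, Tw.μ₂_zero_left, Tw.μ₂_zero_right,
        add_zero, zero_add, Quiver.Path.length_nil, Nat.cast_zero, neg_zero,
        Int.negOnePow_zero, one_smul]
      funext a c
      simp only [Tw.μ₂, Tw.single_sum, Tw.single_deg, sub_zero, Int.negOnePow_zero, one_smul]
      rfl
    | .cons (.cons (.cons p f) g) h =>
      rw [List.sum_eq_zero, List.sum_eq_zero]
      · intro x hx
        obtain ⟨c, hc, rfl⟩ := List.mem_map.1 hx
        have := length_of_mem_contractions _ c hc
        simp only [Quiver.Path.length_cons] at this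
        rw [inclMap_eq_zero _ (by omega), smul_zero]
      · intro x hx
        obtain ⟨s, hs, rfl⟩ := List.mem_map.1 hx
        have := length_of_mem_splits _ s hs
        simp only [Quiver.Path.length_cons] at this
        by_cases h1 : s.2.1.length = 1
        · rw [inclMap_eq_zero s.2.2 (by omega), Tw.μ₂_zero_left]
        · rw [inclMap_eq_zero s.2.1 h1, Tw.μ₂_zero_right]

end Functors

/-! ### The category of the generators `T_0, …, T_n` -/

/-- The objects `T_0, …, T_n` attached to `n` punctures. -/
structure KLRW (k : Type u) (n : ℕ) where
  idx : Fin (n + 1)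

/-- The exponent `δ(x, y, z)` in `a_{zy}s^β · a_{yx}s^α = a_{zx}s^{α + β + δ(x, y, z)}`. -/
def crossing (x y z : ℤ) : ℕ :=
  if 0 ≤ (x - y) * (y - z) then 0 else min (x - y).natAbs (y - z).natAbs

theorem crossing_eq (x y z : ℤ) :
    2 * (crossing x y z : ℤ) = |x - y| + |y - z| - |x - z| := by
  unfold crossing
  split_ifs with h
  · rcases mul_nonneg_iff.1 h with ⟨h1, h2⟩ | ⟨h1, h2⟩
    · rw [abs_of_nonneg h1, abs_of_nonneg h2, abs_of_nonneg (by omega)]; push_cast; omega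
    · rw [abs_of_nonpos h1, abs_of_nonpos h2, abs_of_nonpos (by omega)]; push_cast; omega
  · have h3 := abs_eq_max_neg (a := x - y)
    have h4 := abs_eq_max_neg (a := y - z)
    have h5 := abs_eq_max_neg (a := x - z)
    rcases mul_neg_iff.1 (not_le.1 h) with ⟨h1, h2⟩ | ⟨h1, h2⟩ <;> omega

namespace KLRW

variable {k : Type u} {n : ℕ}

/-- The index `j` of `T_j`, as an integer. -/
def pos (Y : KLRW k n) : ℤ := ((Y.idx : ℕ) : ℤ)

variable [Field k]

/-- `Hom(T_i, T_j) = ⨁_α k a_{ji}s^α`, where `a_{ji}s^α` is the monomial `X^α` of `k[X]`. -/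
noncomputable instance : Category.{u} (KLRW k n) where
  Hom _ _ := k[X]
  id _ := (1 : k[X])
  comp {T U V} f g := (f * g * X ^ crossing T.pos U.pos V.pos : k[X])
  id_comp {T U} f := by
    have h := crossing_eq T.pos T.pos U.pos
    have h' : crossing T.pos T.pos U.pos = 0 := by simp at h; exact h
    simp [h']
  comp_id {T U} f := by
    have h := crossing_eq T.pos U.pos U.pos
    have h' : crossing T.pos U.pos U.pos = 0 := by simp at h; exact h
    simp [h']
  assoc {T U V W} f g h := by
    have h1 := crossing_eq T.pos U.pos V.pos
    have h2 := crossing_eq T.pos V.pos W.pos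
    have h3 := crossing_eq U.pos V.pos W.pos
    have h4 := crossing_eq T.pos U.pos W.pos
    have e : crossing T.pos U.pos V.pos + crossing T.pos V.pos W.pos
        = crossing U.pos V.pos W.pos + crossing T.pos U.pos W.pos := by omega
    calc f * g * X ^ crossing T.pos U.pos V.pos * h * X ^ crossing T.pos V.pos W.pos
        = f * g * h * X ^ (crossing T.pos U.pos V.pos + crossing T.pos V.pos W.pos) := by
          rw [pow_add]; ring
      _ = f * (g * h * X ^ crossing U.pos V.pos W.pos) * X ^ crossing T.pos U.pos W.pos := by
          rw [e, pow_add]; ring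

noncomputable instance : Preadditive (KLRW k n) where
  homGroup _ _ := inferInstanceAs (AddCommGroup k[X])
  add_comp T U V f f' g := by
    have h : ∀ (a b c d : k[X]), (a + b) * c * d = a * c * d + b * c * d := fun _ _ _ _ => by ring
    exact h f f' g _
  comp_add T U V f g g' := by
    have h : ∀ (a b c d : k[X]), a * (b + c) * d = a * b * d + a * c * d := fun _ _ _ _ => by ring
    exact h f g g' _

noncomputable instance : Linear k (KLRW k n) where
  homModule _ _ := inferInstanceAs (Module k k[X])
  smul_comp T U V r f g := by
    have h : ∀ (a b c : k[X]), (r • a) * b * c = r • (a * b * c) := fun _ _ _ => by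
      simp only [smul_mul_assoc]
    exact h f g _
  comp_smul T U V f r g := by
    have h : ∀ (a b c : k[X]), a * (r • b) * c = r • (a * b * c) := fun _ _ _ => by
      simp only [smul_mul_assoc, mul_smul_comm]
    exact h f g _

end KLRW

/-! ### The negative braiding functor

The functor exchanges the punctures number `i` and `i + 1`, where `0 < i < n`. The object `T_j` is
left unchanged for `j ≠ i`, and `T_i` goes to `T_i ⟶ T_{i-1} ⊕ T_{i+1}`. -/

/-- Labels for the summands of `β T_j`. The summand `main` is `T_j`; the summands `left` and `right`
are `T_{i-1}` and `T_{i+1}`, and are present for `j = i` only. -/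
inductive Slot
  | main
  | left
  | right
  deriving DecidableEq

instance : Fintype Slot := ⟨{.main, .left, .right}, by rintro (_ | _ | _) <;> simp⟩

section Braiding

variable {k : Type u} [Field k] {n : ℕ} (i : ℕ)

/-- The position of a summand of `β T_j`. -/
def slotPos (j : ℤ) : Slot → ℤ
  | .main => j
  | .left => i - 1
  | .right => i + 1

/-- The degree of a summand of `β T_j`. -/
def slotDeg (j : ℤ) : Slot → ℤ
  | .main => if j = i then -1 else 0
  | _ => 0

/-- The bounding cochain `(a_{i-1,i}, -a_{i+1,i}) : T_i ⟶ T_{i-1} ⊕ T_{i+1}`. -/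
noncomputable def slotδ : Slot → Slot → k[X]
  | .main, .left => 1
  | .main, .right => -1
  | _, _ => 0

/-- The action `β^1` on the morphism `a_{lj} f(s)` from `T_j` to `T_l`. -/
noncomputable def braid₁ (j l : ℤ) (f : k[X]) : Slot → Slot → k[X] :=
  if j ≠ i then
    if l ≠ i then
      fun
        | .main, .main => f
        | _, _ => 0
    else
      fun
        | .main, .left => if j < i then f else 0
        | .main, .right => if i < j then f else 0
        | _, _ => 0
  else
    if l ≠ i then
      fun
        | .left, .main => if i < l then f else f * X
        | .right, .main => if i < l then f * X else f
        | _, _ => 0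
    else
      fun s t => if s = t then f else 0

/-- The component `β^2` on the morphisms `a_{ml} g(s)` and `a_{lj} f(s)`. -/
noncomputable def braid₂ (j l m : ℤ) (g f : k[X]) : Slot → Slot → k[X] :=
  if m ≠ i then fun _ _ => 0
  else
    if j ≠ i then
      fun
        | .main, .main =>
            if (i - j) * (i - l) < 0 then
              (i - l : ℤ).sign • (g * f * X ^ ((i - l : ℤ).natAbs - 1))
            else 0
        | _, _ => 0
    else
      fun
        | .left, .main =>
            if i < l then (i - l : ℤ).sign • (g * f * X ^ ((i - l : ℤ).natAbs - 1)) else 0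
        | .right, .main =>
            if l < i then (i - l : ℤ).sign • (g * f * X ^ ((i - l : ℤ).natAbs - 1)) else 0
        | _, _ => 0

variable {i} (hi : 0 < i) (hn : i < n)

/-- The twisted complex `β T_j`. -/
noncomputable def braidObj (Y : KLRW k n) : Tw (KLRW k n) where
  ι := {s : Slot // s = .main ∨ Y.pos = i}
  obj s := match s.1 with
    | .main => Y
    | .left => ⟨⟨i - 1, by omega⟩⟩
    | .right => ⟨⟨i + 1, by omega⟩⟩
  deg s := slotDeg i Y.pos s.1
  δ s t := (slotδ s.1 t.1 : k[X])
  δ_deg := by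
    rintro ⟨s, hs⟩ ⟨t, ht⟩ h
    have : (slotδ s t : k[X]) = 0 := by
      cases s <;> cases t <;> simp_all [slotδ, slotDeg] <;> split_ifs at h <;> simp_all
    exact this
  δ_sq := by
    rintro ⟨s, hs⟩ ⟨u, hu⟩
    refine Finset.sum_eq_zero ?_
    rintro ⟨t, ht⟩ -
    have : (slotδ s t * slotδ t u : k[X]) = 0 := by
      cases s <;> cases t <;> cases u <;> simp [slotδ]
    change (slotδ s t * slotδ t u * _ : k[X]) = 0
    rw [this, zero_mul]

/-- The morphism `β Y ⟶ β Z` with the given matrix entries. -/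
noncomputable def slotHom (Y Z : KLRW k n) (Φ : Slot → Slot → k[X]) :
    Tw.Hom (braidObj hi hn Y) (braidObj hi hn Z) :=
  fun s t => (Φ s.1 t.1 : k[X])

/-- The components of the negative braiding functor. -/
noncomputable def braidMap : ∀ {Y Z : KLRW k n}, Quiver.Path Y Z →
    Tw.Hom (braidObj hi hn Y) (braidObj hi hn Z)
  | _, _, .nil => 0
  | Y, Z, .cons .nil f => slotHom hi hn Y Z (braid₁ i Y.pos Z.pos f)
  | Y, Z, .cons (.cons (c := U) .nil f) g =>
      slotHom hi hn Y Z (braid₂ i Y.pos U.pos Z.pos g f)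
  | _, _, .cons (.cons (.cons _ _) _) _ => 0

variable (i) in
/-- The product `μ²` in terms of the summands. -/
noncomputable def slotμ₂ (x y z : ℤ) (ψ φ : Slot → Slot → k[X]) (s t : Slot) : k[X] :=
  let term (r : Slot) : k[X] := (slotDeg i y r - slotDeg i x s).negOnePow •
    (φ s r * ψ r t * X ^ crossing (slotPos i x s) (slotPos i y r) (slotPos i z t))
  term .main + if y = i then term .left + term .right else 0

variable (i) in
/-- The second part `φ δ` of the differential `μ¹` in terms of the summands. -/
noncomputable def slotμ₁' (x y : ℤ) (φ : Slot → Slot → k[X]) (s t : Slot) : k[X] :=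
  let term (r : Slot) : k[X] :=
    slotδ s r * φ r t * X ^ crossing (slotPos i x s) (slotPos i x r) (slotPos i y t)
  term .main + if x = i then term .left + term .right else 0

variable (i) in
/-- The differential `μ¹` in terms of the summands. -/
noncomputable def slotμ₁ (x y : ℤ) (φ : Slot → Slot → k[X]) (s t : Slot) : k[X] :=
  slotμ₂ i x y y slotδ φ s t - slotμ₁' i x y φ s t

/-! The equations for the functor are checked after the substitution `X = u²` and a rescaling of
`a_{ji}` by `u ^ |i - j|`, which turns the composition into the product. -/

variable (k) in
/-- The square root `u` of the variable. -/
noncomputable def root : FractionRing k[X] := algebraMap k[X] _ X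

theorem root_ne_zero : root k ≠ 0 := by
  simp [root]

/-- The rescaled morphism. -/
noncomputable def gauge (a b : ℤ) (f : k[X]) : FractionRing k[X] :=
  algebraMap k[X] _ (expand k 2 f) * root k ^ |a - b|

theorem gauge_def (a b : ℤ) (f : k[X]) :
    gauge a b f = algebraMap k[X] _ (expand k 2 f) * root k ^ |a - b| := rfl

theorem gauge_injective (a b : ℤ) {f g : k[X]} (h : gauge a b f = gauge a b g) : f = g := by
  have h' := mul_right_cancel₀ (zpow_ne_zero _ root_ne_zero) h
  exact expand_injective (by norm_num) (IsFractionRing.injective k[X] (FractionRing k[X]) h')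

@[simp] theorem gauge_zero (a b : ℤ) : gauge a b (0 : k[X]) = 0 := by simp [gauge]

@[simp] theorem gauge_neg (a b : ℤ) (f : k[X]) : gauge a b (-f) = -gauge a b f := by simp [gauge]

@[simp] theorem gauge_add (a b : ℤ) (f g : k[X]) :
    gauge a b (f + g) = gauge a b f + gauge a b g := by simp [gauge, add_mul]

@[simp] theorem gauge_sub (a b : ℤ) (f g : k[X]) :
    gauge a b (f - g) = gauge a b f - gauge a b g := by simp [gauge, sub_mul]

@[simp] theorem gauge_units_smul (a b : ℤ) (r : ℤˣ) (f : k[X]) :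
    gauge a b (r • f) = r • gauge a b f := by
  rcases Int.units_eq_one_or r with rfl | rfl <;> simp [Units.smul_def]

theorem gauge_comp (a b c : ℤ) (f g : k[X]) :
    gauge a c (f * g * X ^ crossing a b c) = gauge a b f * gauge b c g := by
  have h : root k ^ (2 * (crossing a b c : ℤ)) * root k ^ |a - c|
      = root k ^ |a - b| * root k ^ |b - c| := by
    rw [crossing_eq, ← zpow_add₀ root_ne_zero, ← zpow_add₀ root_ne_zero]
    congr 1; ring
  have h2 : algebraMap k[X] (FractionRing k[X]) (expand k 2 (X ^ crossing a b c))
      = root k ^ (2 * (crossing a b c : ℤ)) := by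
    rw [map_pow, expand_X, map_pow, map_pow, zpow_mul, zpow_natCast]; rfl
  unfold gauge
  rw [map_mul, map_mul, map_mul, map_mul, h2]
  linear_combination (algebraMap k[X] (FractionRing k[X]) (expand k 2 f)
    * algebraMap k[X] (FractionRing k[X]) (expand k 2 g)) * h

theorem gauge_shift {a b c d : ℤ} (m : ℕ) (f : k[X]) :
    gauge a b (f * X ^ m) = root k ^ (2 * (m : ℤ) + |a - b| - |c - d|) * gauge c d f := by
  have h2 : algebraMap k[X] (FractionRing k[X]) (expand k 2 (X ^ m))
      = root k ^ (2 * (m : ℤ)) := by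
    rw [map_pow, expand_X, map_pow, map_pow, zpow_mul, zpow_natCast]; rfl
  have h : root k ^ (2 * (m : ℤ)) * root k ^ |a - b|
      = root k ^ (2 * (m : ℤ) + |a - b| - |c - d|) * root k ^ |c - d| := by
    rw [← zpow_add₀ root_ne_zero, ← zpow_add₀ root_ne_zero]
    congr 1; ring
  unfold gauge
  rw [map_mul, map_mul, h2]
  linear_combination (algebraMap k[X] (FractionRing k[X]) (expand k 2 f)) * h

theorem gauge_shift₂ {a b c d e : ℤ} (m : ℕ) (g f : k[X]) :
    gauge a b (g * f * X ^ m)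
      = root k ^ (2 * (m : ℤ) + |a - b| - |c - d| - |d - e|) * (gauge c d f * gauge d e g) := by
  have h2 : algebraMap k[X] (FractionRing k[X]) (expand k 2 (X ^ m))
      = root k ^ (2 * (m : ℤ)) := by
    rw [map_pow, expand_X, map_pow, map_pow, zpow_mul, zpow_natCast]; rfl
  have h : root k ^ (2 * (m : ℤ)) * root k ^ |a - b|
      = root k ^ (2 * (m : ℤ) + |a - b| - |c - d| - |d - e|)
        * (root k ^ |c - d| * root k ^ |d - e|) := by
    rw [← zpow_add₀ root_ne_zero, ← zpow_add₀ root_ne_zero, ← zpow_add₀ root_ne_zero]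
    congr 1; ring
  unfold gauge
  rw [map_mul, map_mul, map_mul, map_mul, h2]
  linear_combination (algebraMap k[X] (FractionRing k[X]) (expand k 2 f)
    * algebraMap k[X] (FractionRing k[X]) (expand k 2 g)) * h

attribute [irreducible] gauge

theorem gauge_slotμ₂ (x y z : ℤ) (ψ φ : Slot → Slot → k[X]) (s t : Slot) :
    gauge (slotPos i x s) (slotPos i z t) (slotμ₂ i x y z ψ φ s t) =
      (slotDeg i y .main - slotDeg i x s).negOnePow •
        (gauge (slotPos i x s) (slotPos i y .main) (φ s .main)
          * gauge (slotPos i y .main) (slotPos i z t) (ψ .main t)) +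
      if y = i then
        (slotDeg i y .left - slotDeg i x s).negOnePow •
          (gauge (slotPos i x s) (slotPos i y .left) (φ s .left)
            * gauge (slotPos i y .left) (slotPos i z t) (ψ .left t)) +
        (slotDeg i y .right - slotDeg i x s).negOnePow •
          (gauge (slotPos i x s) (slotPos i y .right) (φ s .right)
            * gauge (slotPos i y .right) (slotPos i z t) (ψ .right t))
      else 0 := by
  unfold slotμ₂
  split_ifs <;> simp only [gauge_add, gauge_units_smul, gauge_comp, gauge_zero]

theorem gauge_slotμ₁' (x y : ℤ) (φ : Slot → Slot → k[X]) (s t : Slot) :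
    gauge (slotPos i x s) (slotPos i y t) (slotμ₁' i x y φ s t) =
      gauge (slotPos i x s) (slotPos i x .main) (slotδ s .main)
          * gauge (slotPos i x .main) (slotPos i y t) (φ .main t) +
      if x = i then
        gauge (slotPos i x s) (slotPos i x .left) (slotδ s .left)
            * gauge (slotPos i x .left) (slotPos i y t) (φ .left t) +
        gauge (slotPos i x s) (slotPos i x .right) (slotδ s .right)
            * gauge (slotPos i x .right) (slotPos i y t) (φ .right t)
      else 0 := by
  unfold slotμ₁'
  split_ifs <;> simp only [gauge_add, gauge_comp, gauge_zero]

variable (k i) in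
/-- The rescaled matrix of `β^1`. -/
noncomputable def gauge₁ (j l : ℤ) : Slot → Slot → FractionRing k[X] :=
  if j ≠ i then
    if l ≠ i then
      fun
        | .main, .main => 1
        | _, _ => 0
    else
      fun
        | .main, .left => if j < i then (root k)⁻¹ else 0
        | .main, .right => if i < j then (root k)⁻¹ else 0
        | _, _ => 0
  else
    if l ≠ i then
      fun
        | .left, .main => root k
        | .right, .main => root k
        | _, _ => 0
    else
      fun s t => if s = t then 1 else 0

variable (k i) in
/-- The rescaled matrix of `β^2`. -/
noncomputable def gauge₂ (j l m : ℤ) : Slot → Slot → FractionRing k[X] :=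
  if m ≠ i then fun _ _ => 0
  else
    if j ≠ i then
      fun
        | .main, .main =>
            if j < i ∧ i < l then -((root k)⁻¹ * (root k)⁻¹)
            else if i < j ∧ l < i then (root k)⁻¹ * (root k)⁻¹ else 0
        | _, _ => 0
    else
      fun
        | .left, .main => if i < l then -(root k)⁻¹ else 0
        | .right, .main => if l < i then (root k)⁻¹ else 0
        | _, _ => 0

theorem gauge_slotδ (j : ℤ) (s t : Slot) (hs : s = .main ∨ j = i) (ht : t = .main ∨ j = i) :
    gauge (slotPos i j s) (slotPos i j t) (slotδ s t : k[X]) =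
      match s, t with
      | .main, .left => root k
      | .main, .right => -root k
      | _, _ => 0 := by
  cases s <;> cases t <;> simp [slotδ, slotPos, gauge_def] <;> simp_all

theorem gauge_eq₀ {a b c d : ℤ} (f : k[X]) (e : ℤ) (h : |a - b| - |c - d| = e) :
    gauge a b f = root k ^ e * gauge c d f := by
  have := gauge_shift (a := a) (b := b) (c := c) (d := d) 0 f
  rw [pow_zero, mul_one] at this
  rw [this, ← h]; simp

theorem gauge_eq₁ {a b c d : ℤ} (f : k[X]) (e : ℤ) (h : 2 + |a - b| - |c - d| = e) :
    gauge a b (f * X) = root k ^ e * gauge c d f := by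
  have := gauge_shift (a := a) (b := b) (c := c) (d := d) 1 f
  rw [pow_one] at this
  rw [this, ← h]; simp

theorem gauge_eq₂ {a b c d e : ℤ} (m : ℕ) (g f : k[X]) (r : ℤ)
    (h : 2 * (m : ℤ) + |a - b| - |c - d| - |d - e| = r) :
    gauge a b (g * f * X ^ m) = root k ^ r * (gauge c d f * gauge d e g) := by
  rw [gauge_shift₂ (c := c) (d := d) (e := e), h]

theorem root_inv : (root k)⁻¹ = root k ^ (-1 : ℤ) := by simp

theorem root_one : root k = root k ^ (1 : ℤ) := by simp

theorem root_inv_inv : (root k)⁻¹ * (root k)⁻¹ = root k ^ (-2 : ℤ) := by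
  rw [show (-2 : ℤ) = -1 + -1 by norm_num, zpow_add₀ root_ne_zero]; simp

theorem vertex_cases (x y : ℤ) :
    (x < y ∧ x ≠ y ∧ ¬ y < x) ∨ x = y ∨ (y < x ∧ x ≠ y ∧ ¬ x < y) := by omega

theorem slot_cases {x : ℤ} {s : Slot} (hs : s = .main ∨ x = i) :
    (x < i ∧ x ≠ i ∧ ¬ i < x ∧ s = .main) ∨ (x = i ∧ s = .main) ∨ (x = i ∧ s = .left) ∨
      (x = i ∧ s = .right) ∨ (i < x ∧ x ≠ i ∧ ¬ x < i ∧ s = .main) := by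
  rcases vertex_cases x i with h | h | h <;> cases s <;> simp_all

set_option maxHeartbeats 1000000 in
theorem gauge_braid₁ (j l : ℤ) (f : k[X]) (s t : Slot) (hs : s = .main ∨ j = i)
    (ht : t = .main ∨ l = i) :
    gauge (slotPos i j s) (slotPos i l t) (braid₁ i j l f s t)
      = gauge₁ k i j l s t * gauge j l f := by
  unfold braid₁ gauge₁
  rcases slot_cases hs with ⟨x1, x2, x3, rfl⟩ | ⟨rfl, rfl⟩ | ⟨rfl, rfl⟩ | ⟨rfl, rfl⟩ |
    ⟨x1, x2, x3, rfl⟩ <;>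
  rcases slot_cases ht with ⟨y1, y2, y3, rfl⟩ | ⟨rfl, rfl⟩ | ⟨rfl, rfl⟩ | ⟨rfl, rfl⟩ |
    ⟨y1, y2, y3, rfl⟩ <;>
  first
  | (simp [slotPos, *]; done)
  | (simp only [slotPos, ne_eq, not_true_eq_false, not_false_eq_true, if_true, if_false, *]
     first
     | rw [root_inv]
     | skip
     first
     | (with_reducible refine gauge_eq₀ f _ ?_
        simp only [abs_eq_max_neg]; omega)
     | (simp only [gauge_def, sub_self, abs_zero, one_mul]; done)
     | (refine Eq.trans ?_ (congrArg (· * _) root_one.symm)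
        first
        | (with_reducible refine gauge_eq₁ f _ ?_
           simp only [abs_eq_max_neg]; omega)
        | (with_reducible refine gauge_eq₀ f _ ?_
           simp only [abs_eq_max_neg]; omega)))

set_option maxHeartbeats 1000000 in
theorem gauge_braid₂ (j l m : ℤ) (g f : k[X]) (s t : Slot) (hs : s = .main ∨ j = i)
    (ht : t = .main ∨ m = i) :
    gauge (slotPos i j s) (slotPos i m t) (braid₂ i j l m g f s t)
      = gauge₂ k i j l m s t * (gauge j l f * gauge l m g) := by
  unfold braid₂ gauge₂
  rcases slot_cases hs with ⟨x1, x2, x3, rfl⟩ | ⟨rfl, rfl⟩ | ⟨rfl, rfl⟩ | ⟨rfl, rfl⟩ |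
    ⟨x1, x2, x3, rfl⟩ <;>
  rcases vertex_cases l i with ⟨y1, y2, y3⟩ | rfl | ⟨y1, y2, y3⟩ <;>
  rcases slot_cases ht with ⟨z1, z2, z3, rfl⟩ | ⟨rfl, rfl⟩ | ⟨rfl, rfl⟩ | ⟨rfl, rfl⟩ |
    ⟨z1, z2, z3, rfl⟩ <;>
  first
  | (simp [slotPos, mul_neg_iff, *]; done)
  | (have hsg : ((i : ℤ) - l).sign = 1 := Int.sign_eq_one_of_pos (by omega)
     simp only [slotPos, ne_eq, not_true_eq_false, not_false_eq_true, if_true, if_false,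
      mul_neg_iff, sub_pos, sub_neg, and_true, true_and, and_false, false_and, or_false, false_or,
      one_smul, and_self, root_inv_inv, *]
     first
     | (with_reducible refine gauge_eq₂ _ _ _ _ ?_
        simp only [abs_eq_max_neg]; omega)
     | (rw [root_inv]
        with_reducible refine gauge_eq₂ _ _ _ _ ?_
        simp only [abs_eq_max_neg]; omega))
  | (have hsg : ((i : ℤ) - l).sign = -1 := Int.sign_eq_neg_one_of_neg (by omega)
     simp only [slotPos, ne_eq, not_true_eq_false, not_false_eq_true, if_true, if_false,
      mul_neg_iff, sub_pos, sub_neg, and_true, true_and, and_false, false_and, or_false, false_or,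
      neg_smul, one_smul, and_self, gauge_neg, neg_mul, root_inv_inv, *]
     first
     | (with_reducible refine congrArg _ (gauge_eq₂ _ _ _ _ ?_)
        simp only [abs_eq_max_neg]; omega)
     | (rw [root_inv]
        with_reducible refine congrArg _ (gauge_eq₂ _ _ _ _ ?_)
        simp only [abs_eq_max_neg]; omega))

theorem braid_rel₁ (x y : ℤ) (f : k[X]) (s t : Slot) (hs : s = .main ∨ x = i)
    (ht : t = .main ∨ y = i) : slotμ₁ i x y (braid₁ i x y f) s t = 0 := by
  apply gauge_injective (slotPos i x s) (slotPos i y t)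
  unfold slotμ₁
  rw [gauge_sub, gauge_slotμ₂, gauge_slotμ₁']
  rcases slot_cases hs with ⟨x1, x2, x3, rfl⟩ | ⟨rfl, rfl⟩ | ⟨rfl, rfl⟩ | ⟨rfl, rfl⟩ |
    ⟨x1, x2, x3, rfl⟩ <;>
  rcases slot_cases ht with ⟨y1, y2, y3, rfl⟩ | ⟨rfl, rfl⟩ | ⟨rfl, rfl⟩ | ⟨rfl, rfl⟩ |
    ⟨y1, y2, y3, rfl⟩ <;>
  first
  | (simp [gauge_braid₁, gauge_slotδ, gauge₁, slotDeg, *]; done)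
  | (simp [gauge_braid₁, gauge_slotδ, gauge₁, slotDeg, *]; ring; done)

set_option maxHeartbeats 1000000 in
theorem braid_rel₂ (x y z : ℤ) (f g : k[X]) (s t : Slot) (hs : s = .main ∨ x = i)
    (ht : t = .main ∨ z = i) : slotμ₁ i x z (braid₂ i x y z g f) s t
      + slotμ₂ i x y z (braid₁ i y z g) (braid₁ i x y f) s t
      = braid₁ i x z (f * g * X ^ crossing x y z) s t := by
  apply gauge_injective (slotPos i x s) (slotPos i z t)
  have hz : root k ≠ 0 := root_ne_zero
  unfold slotμ₁
  rw [gauge_add, gauge_sub, gauge_slotμ₂, gauge_slotμ₂, gauge_slotμ₁', gauge_braid₁ x z _ s t hs ht,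
    gauge_comp]
  rcases slot_cases hs with ⟨x1, x2, x3, rfl⟩ | ⟨rfl, rfl⟩ | ⟨rfl, rfl⟩ | ⟨rfl, rfl⟩ |
    ⟨x1, x2, x3, rfl⟩ <;>
  rcases vertex_cases y i with ⟨y1, y2, y3⟩ | rfl | ⟨y1, y2, y3⟩ <;>
  rcases slot_cases ht with ⟨z1, z2, z3, rfl⟩ | ⟨rfl, rfl⟩ | ⟨rfl, rfl⟩ | ⟨rfl, rfl⟩ |
    ⟨z1, z2, z3, rfl⟩ <;>
  first
  | (simp [gauge_braid₁, gauge_braid₂, gauge_slotδ, gauge₁, gauge₂, slotDeg, *]; done)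
  | (simp [gauge_braid₁, gauge_braid₂, gauge_slotδ, gauge₁, gauge₂, slotDeg, *]; field_simp; done)
  | (simp [gauge_braid₁, gauge_braid₂, gauge_slotδ, gauge₁, gauge₂, slotDeg, *]; field_simp; ring; done)

set_option maxHeartbeats 4000000 in
theorem braid_rel₃ (x y z w : ℤ) (f g h : k[X]) (s t : Slot) (hs : s = .main ∨ x = i)
    (ht : t = .main ∨ w = i) :
    slotμ₂ i x y w (braid₂ i y z w h g) (braid₁ i x y f) s t
      + slotμ₂ i x z w (braid₁ i z w h) (braid₂ i x y z g f) s t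
      = braid₂ i x z w h (f * g * X ^ crossing x y z) s t
        - braid₂ i x y w (g * h * X ^ crossing y z w) f s t := by
  apply gauge_injective (slotPos i x s) (slotPos i w t)
  have hz : root k ≠ 0 := root_ne_zero
  rw [gauge_add, gauge_sub, gauge_slotμ₂, gauge_slotμ₂, gauge_braid₂ x z w _ _ s t hs ht,
    gauge_braid₂ x y w _ _ s t hs ht, gauge_comp, gauge_comp]
  rcases slot_cases hs with ⟨x1, x2, x3, rfl⟩ | ⟨rfl, rfl⟩ | ⟨rfl, rfl⟩ | ⟨rfl, rfl⟩ |
    ⟨x1, x2, x3, rfl⟩ <;>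
  rcases vertex_cases y i with ⟨y1, y2, y3⟩ | rfl | ⟨y1, y2, y3⟩ <;>
  rcases vertex_cases z i with ⟨z1, z2, z3⟩ | rfl | ⟨z1, z2, z3⟩ <;>
  rcases slot_cases ht with ⟨w1, w2, w3, rfl⟩ | ⟨rfl, rfl⟩ | ⟨rfl, rfl⟩ | ⟨rfl, rfl⟩ |
    ⟨w1, w2, w3, rfl⟩ <;>
  first
  | (simp [gauge_braid₁, gauge_braid₂, gauge₁, gauge₂, slotDeg, *]; done)
  | (simp [gauge_braid₁, gauge_braid₂, gauge₁, gauge₂, slotDeg, *]; field_simp; done)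
  | (simp [gauge_braid₁, gauge_braid₂, gauge₁, gauge₂, slotDeg, *]; field_simp; ring; done)

theorem braid_rel₄ (x y z w v : ℤ) (f g h e : k[X]) (s t : Slot) :
    slotμ₂ i x z v (braid₂ i z w v e h) (braid₂ i x y z g f) s t = 0 := by
  have h1 : ∀ r, r ≠ .main → braid₂ i x y z g f s r = 0 := by
    intro r hr
    unfold braid₂
    split_ifs <;> cases r <;> cases s <;> first | rfl | exact absurd rfl hr
  have h2 : z = i → braid₂ i z w v e h .main t = 0 := by
    rintro rfl
    unfold braid₂
    split_ifs <;> cases t <;> first | rfl | simp_all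
  have h3 : z ≠ i → braid₂ i x y z g f s .main = 0 := by
    intro hz
    simp [braid₂, hz]
  simp only [slotμ₂]
  rw [h1 .left (by simp), h1 .right (by simp)]
  by_cases hz : z = i
  · rw [h2 hz]; simp
  · rw [h3 hz]; simp

theorem braidObj_pos (Y : KLRW k n) (s : (braidObj hi hn Y).ι) :
    ((braidObj hi hn Y).obj s).pos = slotPos i Y.pos s.1 := by
  obtain ⟨s, hs⟩ := s
  cases s with
  | main => rfl
  | left => simp only [braidObj, KLRW.pos, slotPos]; omega
  | right => simp only [braidObj, KLRW.pos, slotPos]; omega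

theorem slot_sum {M : Type*} [AddCommMonoid M] (y : ℤ) (F : Slot → M) :
    ∑ b : {s : Slot // s = .main ∨ y = i}, F b.1
      = F .main + if y = i then F .left + F .right else 0 := by
  have h : ∑ b : {s : Slot // s = .main ∨ y = i}, F b.1
      = ∑ s ∈ Finset.univ.filter (fun s : Slot => s = .main ∨ y = i), F s :=
    (Finset.sum_subtype _ (by simp) F).symm
  rw [h, Finset.sum_filter]
  have hu : (Finset.univ : Finset Slot) = {.main, .left, .right} := rfl
  rw [hu, Finset.sum_insert (by simp), Finset.sum_insert (by simp), Finset.sum_singleton]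
  by_cases hy : y = i <;> simp [hy]

theorem μ₂_slotHom (Y Z W : KLRW k n) (Ψ Φ : Slot → Slot → k[X]) :
    Tw.μ₂ (slotHom hi hn Z W Ψ) (slotHom hi hn Y Z Φ)
      = slotHom hi hn Y W (slotμ₂ i Y.pos Z.pos W.pos Ψ Φ) := by
  funext a c
  refine Eq.trans (Finset.sum_congr rfl fun b _ => ?_) (slot_sum (i := i) Z.pos fun r =>
    (slotDeg i Z.pos r - slotDeg i Y.pos a.1).negOnePow • (Φ a.1 r * Ψ r c.1 *
      X ^ crossing (slotPos i Y.pos a.1) (slotPos i Z.pos r) (slotPos i W.pos c.1) : k[X]))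
  rw [← braidObj_pos hi hn Y a, ← braidObj_pos hi hn Z b, ← braidObj_pos hi hn W c]
  rfl

theorem μ₁_slotHom (Y Z : KLRW k n) (Φ : Slot → Slot → k[X]) :
    Tw.μ₁ (slotHom hi hn Y Z Φ) = slotHom hi hn Y Z (slotμ₁ i Y.pos Z.pos Φ) := by
  funext a c
  have h1 := congrFun (congrFun (μ₂_slotHom hi hn Y Z Z slotδ Φ) a) c
  have h2 : ∑ b, (braidObj hi hn Y).δ a b ≫ slotHom hi hn Y Z Φ b c
      = (slotμ₁' i Y.pos Z.pos Φ a.1 c.1 : k[X]) := by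
    refine Eq.trans (Finset.sum_congr rfl fun b _ => ?_) (slot_sum (i := i) Y.pos fun r =>
      (slotδ a.1 r * Φ r c.1 *
        X ^ crossing (slotPos i Y.pos a.1) (slotPos i Y.pos r) (slotPos i Z.pos c.1) : k[X]))
    rw [← braidObj_pos hi hn Y a, ← braidObj_pos hi hn Y b, ← braidObj_pos hi hn Z c]
    rfl
  exact congrArg₂ (fun p q : k[X] => p - q) h1 h2

theorem slotHom_congr (Y Z : KLRW k n) (Φ Ψ : Slot → Slot → k[X])
    (h : ∀ s t, (s = .main ∨ Y.pos = i) → (t = .main ∨ Z.pos = i) → Φ s t = Ψ s t) :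
    slotHom hi hn Y Z Φ = slotHom hi hn Y Z Ψ := by
  funext a c
  exact h a.1 c.1 a.2 c.2

theorem braidMap_eq_zero {Y Z : KLRW k n} (p : Quiver.Path Y Z)
    (h : p.length = 0 ∨ 3 ≤ p.length) : braidMap hi hn p = 0 := by
  match p, h with
  | .nil, _ => rfl
  | .cons .nil f, h => simp at h
  | .cons (.cons .nil f) g, h => simp at h
  | .cons (.cons (.cons _ _) _) _, _ => rfl

theorem braid₁_add (j l : ℤ) (f f' : k[X]) :
    braid₁ i j l (f + f') = braid₁ i j l f + braid₁ i j l f' := by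
  funext s t
  unfold braid₁
  split_ifs <;> cases s <;> cases t <;> simp [add_mul]

theorem braid₁_smul (j l : ℤ) (r : k) (f : k[X]) :
    braid₁ i j l (r • f) = r • braid₁ i j l f := by
  funext s t
  unfold braid₁
  split_ifs <;> cases s <;> cases t <;> simp

theorem braid₂_add_left (j l m : ℤ) (g g' f : k[X]) :
    braid₂ i j l m (g + g') f = braid₂ i j l m g f + braid₂ i j l m g' f := by
  funext s t
  unfold braid₂
  split_ifs <;> cases s <;> cases t <;> simp [add_mul]

theorem braid₂_add_right (j l m : ℤ) (g f f' : k[X]) :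
    braid₂ i j l m g (f + f') = braid₂ i j l m g f + braid₂ i j l m g f' := by
  funext s t
  unfold braid₂
  split_ifs <;> cases s <;> cases t <;> simp [add_mul, mul_add]

theorem braid₂_smul_left (j l m : ℤ) (r : k) (g f : k[X]) :
    braid₂ i j l m (r • g) f = r • braid₂ i j l m g f := by
  funext s t
  unfold braid₂
  split_ifs <;> cases s <;> cases t <;> simp

theorem braid₂_smul_right (j l m : ℤ) (r : k) (g f : k[X]) :
    braid₂ i j l m g (r • f) = r • braid₂ i j l m g f := by
  funext s t
  unfold braid₂
  split_ifs <;> cases s <;> cases t <;> simp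

/-- The negative braiding functor. -/
noncomputable def braidFunctor : AInfFunctor k (KLRW k n) where
  obj := braidObj hi hn
  map := braidMap hi hn
  map_nil _ := rfl
  map_linear {Y Z U W} p q := by
    match p, q with
    | .nil, .nil =>
      exact ⟨fun f f' => congrArg (slotHom hi hn Y U) (braid₁_add Y.pos U.pos f f'),
        fun r f => congrArg (slotHom hi hn Y U) (braid₁_smul Y.pos U.pos r f)⟩
    | .nil, .cons .nil g =>
      exact ⟨fun f f' => congrArg (slotHom hi hn Y W) (braid₂_add_right Y.pos U.pos W.pos g f f'),
        fun r f => congrArg (slotHom hi hn Y W) (braid₂_smul_right Y.pos U.pos W.pos r g f)⟩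
    | .cons .nil g, .nil =>
      exact ⟨fun f f' => congrArg (slotHom hi hn Y U) (braid₂_add_left Y.pos Z.pos U.pos f f' g),
        fun r f => congrArg (slotHom hi hn Y U) (braid₂_smul_left Y.pos Z.pos U.pos r f g)⟩
    | .cons (.cons p a) b, q =>
      have : ∀ f : Z ⟶ U, braidMap hi hn ((((p.cons a).cons b).cons f).comp q) = 0 :=
        fun f => braidMap_eq_zero hi hn _ (Or.inr (by simp; omega))
      simp only [this]
      exact ⟨by simp, by simp⟩
    | p, .cons (.cons q a) b =>
      have : ∀ f : Z ⟶ U, braidMap hi hn ((p.cons f).comp ((q.cons a).cons b)) = 0 :=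
        fun f => braidMap_eq_zero hi hn _ (Or.inr (by simp; omega))
      simp only [this]
      exact ⟨by simp, by simp⟩
    | .cons p a, .cons q b =>
      have : ∀ f : Z ⟶ U, braidMap hi hn (((p.cons a).cons f).comp (q.cons b)) = 0 :=
        fun f => braidMap_eq_zero hi hn _ (Or.inr (by simp; omega))
      simp only [this]
      exact ⟨by simp, by simp⟩
  map_deg {Y Z} p := by
    match p with
    | .nil => intro a b _; rfl
    | .cons .nil f =>
      rintro ⟨s, hs⟩ ⟨t, ht⟩ h
      have : braid₁ i Y.pos Z.pos f s t = 0 := by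
        by_contra h'
        refine h ?_
        simp only [braidObj, Quiver.Path.length_cons, Quiver.Path.length_nil]
        unfold braid₁ at h'
        split_ifs at h' <;> cases s <;> cases t <;> simp_all [slotDeg]
      exact this
    | .cons (.cons (c := U) .nil f) g =>
      rintro ⟨s, hs⟩ ⟨t, ht⟩ h
      have : braid₂ i Y.pos U.pos Z.pos g f s t = 0 := by
        by_contra h'
        refine h ?_
        simp only [braidObj, Quiver.Path.length_cons, Quiver.Path.length_nil]
        unfold braid₂ at h'
        split_ifs at h' <;> cases s <;> cases t <;> simp_all [slotDeg]
      exact this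
    | .cons (.cons (.cons _ _) _) _ => intro a b _; rfl
  map_rel {Y Z} p := by
    have h0 : ∀ U : KLRW k n, braidMap hi hn (.nil : Quiver.Path U U) = 0 := fun _ => rfl
    match p with
    | .nil => simp [splits, contractions, h0]
    | .cons .nil f =>
      simp only [splits, contractions, h0, List.map_cons, List.map_nil, List.nil_append,
        List.cons_append, List.sum_cons, List.sum_nil, Tw.μ₂_zero_left, Tw.μ₂_zero_right,
        add_zero]
      refine (μ₁_slotHom hi hn Y Z _).trans (slotHom_congr hi hn Y Z _ 0 ?_)
      exact fun s t hs ht => braid_rel₁ Y.pos Z.pos f s t hs ht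
    | .cons (.cons (c := U) .nil f) g =>
      simp only [splits, contractions, h0, List.map_cons, List.map_nil, List.nil_append,
        List.cons_append, List.sum_cons, List.sum_nil, Tw.μ₂_zero_left, Tw.μ₂_zero_right,
        add_zero, zero_add, Quiver.Path.length_nil, Nat.cast_zero, neg_zero,
        Int.negOnePow_zero, one_smul]
      refine (congrArg₂ (· + ·) (μ₁_slotHom hi hn Y Z _) (μ₂_slotHom hi hn Y U Z _ _)).trans ?_
      refine slotHom_congr hi hn Y Z (slotμ₁ i _ _ _ + slotμ₂ i _ _ _ _ _) _ ?_
      exact fun s t hs ht => braid_rel₂ Y.pos U.pos Z.pos f g s t hs ht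
    | .cons (.cons (c := V) (.cons (c := U) .nil f) g) h =>
      have hz : braidMap hi hn (((Quiver.Path.nil.cons f).cons g).cons h) = 0 := rfl
      simp only [splits, contractions, h0, List.map_cons, List.map_nil, List.nil_append,
        List.cons_append, List.sum_cons, List.sum_nil, Tw.μ₂_zero_left, Tw.μ₂_zero_right,
        add_zero, zero_add, Quiver.Path.length_nil, Quiver.Path.length_cons, Nat.cast_zero,
        neg_zero, Int.negOnePow_zero, one_smul, hz, Tw.μ₁_zero, Nat.cast_one, Int.negOnePow_neg,
        Int.negOnePow_one, Units.neg_smul]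
      refine (congrArg₂ (· + ·) (μ₂_slotHom hi hn Y U Z _ _) (μ₂_slotHom hi hn Y V Z _ _)).trans ?_
      refine Eq.trans (slotHom_congr hi hn Y Z
        (slotμ₂ i Y.pos U.pos Z.pos (braid₂ i U.pos V.pos Z.pos h g) (braid₁ i Y.pos U.pos f)
          + slotμ₂ i Y.pos V.pos Z.pos (braid₁ i V.pos Z.pos h) (braid₂ i Y.pos U.pos V.pos g f))
        (braid₂ i Y.pos V.pos Z.pos h (f ≫ g)
          - braid₂ i Y.pos U.pos Z.pos (g ≫ h) f) ?_) ?_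
      · exact fun s t hs ht => braid_rel₃ Y.pos U.pos V.pos Z.pos f g h s t hs ht
      · exact sub_eq_add_neg _ _
    | .cons (.cons (.cons (.cons p e) f) g) h =>
      have h4 : ∀ {U V : KLRW k n} (q : Quiver.Path U V),
          q.length = p.length + 3 ∨ q.length = p.length + 4 → braidMap hi hn q = 0 :=
        fun q hq => braidMap_eq_zero hi hn q (by omega)
      rw [h4 _ (Or.inr rfl), Tw.μ₁_zero, zero_add, List.sum_eq_zero, List.sum_eq_zero]
      · intro x hx
        obtain ⟨c, hc, rfl⟩ := List.mem_map.1 hx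
        have := length_of_mem_contractions _ c hc
        simp only [Quiver.Path.length_cons] at this
        rw [braidMap_eq_zero hi hn _ (by omega), smul_zero]
      · intro x hx
        obtain ⟨⟨W, q, r⟩, hs, rfl⟩ := List.mem_map.1 hx
        have := length_of_mem_splits _ _ hs
        simp only [Quiver.Path.length_cons] at this ⊢
        by_cases h1 : q.length = 0 ∨ 3 ≤ q.length
        · rw [braidMap_eq_zero hi hn q h1, Tw.μ₂_zero_right]
        by_cases h2 : r.length = 0 ∨ 3 ≤ r.length
        · rw [braidMap_eq_zero hi hn r h2, Tw.μ₂_zero_left]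
        have h5 : q.length = 2 := by omega
        have h6 : r.length = 2 := by omega
        clear hs hx this h1 h2
        match q, r, h5, h6 with
        | .cons (.cons (c := A) .nil a) b, .cons (.cons (c := B) .nil c) d, _, _ =>
          refine (μ₂_slotHom hi hn Y W Z _ _).trans (slotHom_congr hi hn Y Z _ 0 ?_)
          exact fun s t _ _ => braid_rel₄ Y.pos A.pos W.pos B.pos Z.pos a b c d s t
        | .nil, _, h5, _ => simp at h5
        | .cons .nil _, _, h5, _ => simp at h5
        | .cons (.cons (.cons _ _) _) _, _, h5, _ => simp at h5
        | _, .nil, _, h5 => simp at h5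
        | _, .cons .nil _, _, h5 => simp at h5
        | _, .cons (.cons (.cons _ _) _) _, _, h5 => simp at h5

/-- The component `η⁰(T_j)`: it is `∑ ε_ℓ s^ℓ` for `j ≠ i` and the pair of `∑ ½ ε_ℓ a_{i-1,i}s^{ℓ-1}`
and `∑ ½ ε_ℓ a_{i+1,i}s^{ℓ-1}` for `j = i`. -/
noncomputable def braidNat₀ (ε : ℕ+ →₀ k) (Y : KLRW k n) :
    Tw.Hom ((incl k (KLRW k n)).obj Y) ((braidFunctor hi hn).obj Y) := fun _ t =>
  match t.1 with
  | .main => if Y.pos = i then (0 : k[X]) else (ε.sum fun ℓ c => monomial (ℓ : ℕ) c : k[X])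
  | _ => (ε.sum fun ℓ c => monomial ((ℓ : ℕ) - 1) (c / 2) : k[X])

/-- The component `η¹` on a morphism `a_{kj}f(s)`: it vanishes for `k ≠ i`, and it is
`sgn(i - j) ∑ ½ ε_ℓ a_{ij}s^{ℓ-1}f(s)`, a morphism to the summand `T_i` of `β T_i`, for `k = i`. -/
noncomputable def braidNat₁ (ε : ℕ+ →₀ k) {Y Z : KLRW k n} (f : Y ⟶ Z) :
    Tw.Hom ((incl k (KLRW k n)).obj Y) ((braidFunctor hi hn).obj Z) := fun _ t =>
  match t.1 with
  | .main =>
      if Z.pos = i then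
        ((i - Y.pos : ℤ).sign • (ε.sum fun ℓ c => monomial ((ℓ : ℕ) - 1) (c / 2) * f : k[X]) : k[X])
      else (0 : k[X])
  | _ => (0 : k[X])

/-- The family `η` with components `η⁰`, `η¹` as above and `η^d = 0` for `d ≥ 2`. -/
noncomputable def braidNat (ε : ℕ+ →₀ k) : Family (incl k (KLRW k n)) (braidFunctor hi hn)
  | Y, _, .nil => braidNat₀ hi hn ε Y
  | _, _, .cons .nil f => braidNat₁ hi hn ε f
  | _, _, .cons (.cons _ _) _ => 0

end Braiding

end Braid

/-! The summands of every `β T_l` lie in degrees `0` and `-1`, and the only summand of degree `-1`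
is the copy of `T_i` in `β T_i`. A degree `0` pre-natural transformation therefore has only two
components. The first is `η⁰`: a polynomial for each `T_j` with `j ≠ i`, and a pair `(L, R)` of
polynomials, the entries into `T_{i-1}` and `T_{i+1}`, for `T_i`. The second is `η¹` on morphisms
into `T_i`, with values in the degree `-1` summand.

For a cocycle, the pair `(L, R)` determines everything. On a morphism `f : T_j ⟶ T_i` with `j ≠ i`,
the functor `β¹` reaches only the neighbour of `T_i` on the side of `j`. The cocycle equation at the
other neighbour gives `η¹(f) = f R` for `j < i` and `η¹(f) = -f L` for `j > i`. At the near
neighbour it gives `η⁰(T_j) = s (L + R)`. For `j = i` it gives `η¹(f) = 0`. Chains of length one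
suffice here (`col_single_main_of_lt`, `col_single_main_of_gt`, `col_single_main_of_eq`,
`col_nil_main_of_ne`).

A pre-natural transformation of degree `-1` reduces to one polynomial, its value on `T_i`. Its
differential adds opposite polynomials to `L` and `R`, so `L + R` is an invariant of the cohomology
class (`col_add_col_of_mem_coboundaries`). Conversely, a cocycle with `L + R = 0` is a coboundary,
because `L` alone then determines it (`mem_coboundaries`).

Thus a class amounts to the polynomial `L + R`. Each value is attained by exactly one `η_ε`, since
`L = R = ∑ ½ ε_ℓ s^{ℓ-1}` there and `2` is invertible. What remains is that `η_ε` is a cocycle. On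
chains of length one or two this is a finite check on the positions relative to `i`
(`braidNat_rel_single`, `braidNat_rel_pair`), and longer chains contribute nothing
(`natDiffFun_long`). -/

namespace Braid

section BraidNat

variable {k : Type u} [Field k] {n : ℕ} {i : ℕ} (hi : 0 < i) (hn : i < n)

/-! ### Morphisms `T_j ⟶ β T_l` as columns -/

/-- The morphism `Y ⟶ β Z` with the given entries. -/
def colHom (Y Z : KLRW k n) (φ : Slot → k[X]) :
    Tw.Hom ((incl k (KLRW k n)).obj Y) ((braidFunctor hi hn).obj Z) :=
  fun _ t => (φ t.1 : k[X])

open Classical in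
/-- The entries of a morphism `Y ⟶ β Z`, extended by zero. -/
noncomputable def col {Y Z : KLRW k n}
    (φ : Tw.Hom ((incl k (KLRW k n)).obj Y) ((braidFunctor hi hn).obj Z)) : Slot → k[X] :=
  fun t => if h : t = .main ∨ Z.pos = i then φ () ⟨t, h⟩ else 0

theorem col_apply {Y Z : KLRW k n}
    (φ : Tw.Hom ((incl k (KLRW k n)).obj Y) ((braidFunctor hi hn).obj Z)) {t : Slot}
    (h : t = .main ∨ Z.pos = i) : col hi hn φ t = φ () ⟨t, h⟩ :=
  dif_pos h

/-- The source has a single summand, so a column loses nothing. This lets arbitrary transformations,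
not only `η_ε`, be computed entrywise. -/
theorem colHom_col {Y Z : KLRW k n}
    (φ : Tw.Hom ((incl k (KLRW k n)).obj Y) ((braidFunctor hi hn).obj Z)) :
    colHom hi hn Y Z (col hi hn φ) = φ := by
  funext a t
  exact col_apply hi hn φ t.2

theorem colHom_eq_iff {Y Z : KLRW k n} {φ ψ : Slot → k[X]} :
    colHom hi hn Y Z φ = colHom hi hn Y Z ψ ↔
      ∀ t, (t = .main ∨ Z.pos = i) → φ t = ψ t :=
  ⟨fun h t ht => congrFun (congrFun h ()) ⟨t, ht⟩, fun h => by
    funext a t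
    exact h t.1 t.2⟩

theorem colHom_combine (Y Z : KLRW k n) (u : ℤˣ) (p q r s : Slot → k[X]) :
    colHom hi hn Y Z q + colHom hi hn Y Z r + u • colHom hi hn Y Z p - u • colHom hi hn Y Z s
      = colHom hi hn Y Z (r + q + u • p - u • s) := by
  rw [add_comm (colHom hi hn Y Z q)]
  rfl

variable (i) in
/-- The product `μ²(ψ, φ)` in terms of entries, for a column `φ`. -/
noncomputable def colμ₂ (x y z : ℤ) (ψ : Slot → Slot → k[X]) (φ : Slot → k[X]) (t : Slot) :
    k[X] :=
  let term (r : Slot) : k[X] := (slotDeg i y r).negOnePow •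
    (φ r * ψ r t * X ^ crossing x (slotPos i y r) (slotPos i z t))
  term .main + if y = i then term .left + term .right else 0

theorem μ₂_colHom (Y Z W : KLRW k n) (Ψ : Slot → Slot → k[X]) (φ : Slot → k[X]) :
    Tw.μ₂ (slotHom hi hn Z W Ψ) (colHom hi hn Y Z φ)
      = colHom hi hn Y W (colμ₂ i Y.pos Z.pos W.pos Ψ φ) := by
  funext a c
  refine Eq.trans (Finset.sum_congr rfl fun b _ => ?_) (slot_sum (i := i) Z.pos fun r =>
    (slotDeg i Z.pos r).negOnePow • (φ r * Ψ r c.1 *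
      X ^ crossing Y.pos (slotPos i Z.pos r) (slotPos i W.pos c.1) : k[X]))
  -- The subtracted `0` is the degree of the only summand of the source.
  rw [← braidObj_pos hi hn Z b, ← braidObj_pos hi hn W c, ← sub_zero (slotDeg i Z.pos b.1)]
  rfl

variable (i) in
/-- The product `μ²(φ, f)` in terms of entries, for a column `φ`. -/
noncomputable def colComp (x y z : ℤ) (φ : Slot → k[X]) (f : k[X]) (t : Slot) : k[X] :=
  f * φ t * X ^ crossing x y (slotPos i z t)

/-- The source has zero bounding cochain, so only `δ φ` survives, and it carries the same sign as
the product `μ²(δ, φ)`. -/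
theorem μ₁_colHom (Y Z : KLRW k n) (φ : Slot → k[X]) :
    Tw.μ₁ (colHom hi hn Y Z φ)
      = colHom hi hn Y Z (colμ₂ i Y.pos Z.pos Z.pos slotδ φ) := by
  rw [← μ₂_colHom]
  funext a c
  refine (congrArg (_ - ·) (Finset.sum_eq_zero fun b _ => ?_)).trans (sub_zero _)
  exact Limits.zero_comp

theorem μ₂_colHom_incl {Y Z : KLRW k n} (W : KLRW k n) (f : Y ⟶ Z) (φ : Slot → k[X]) :
    Tw.μ₂ (colHom hi hn Z W φ) ((incl k (KLRW k n)).map (.cons .nil f))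
      = colHom hi hn Y W (colComp i Y.pos Z.pos W.pos φ f) := by
  funext a c
  refine (Tw.single_sum Z _).trans ?_
  refine (one_smul ℤˣ _).trans ?_
  refine Eq.trans ?_ (congrArg (fun x => (HMul.hMul (α := k[X]) (HMul.hMul (α := k[X]) f (φ c.1))
    (X ^ crossing Y.pos Z.pos x))) (braidObj_pos hi hn W c))
  rfl

/-! ### The differential on chains -/

variable {hi hn} {η : Family (incl k (KLRW k n)) (braidFunctor hi hn)} (g : ℤ)

theorem natDiffFun_nil {Y : KLRW k n} {a : Slot → k[X]} (ha : η Y Y .nil = colHom hi hn Y Y a) :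
    natDiffFun _ _ g η Y Y .nil
      = colHom hi hn Y Y (colμ₂ i Y.pos Y.pos Y.pos slotδ a) := by
  have h0 : ∀ U, (braidFunctor (k := k) hi hn).map (.nil : Quiver.Path U U) = 0 := fun _ => rfl
  have h1 : ∀ U, (incl k (KLRW k n)).map (.nil : Quiver.Path U U) = 0 := fun _ => rfl
  rw [← μ₁_colHom, ← ha]
  simp [natDiffFun, splits, contractions, h0, h1]

/-- Functors vanish on empty chains and a single morphism has no neighbour to be composed with,
which leaves three terms. -/
theorem natDiffFun_single {Y Z : KLRW k n} (f : Y ⟶ Z) {a b c : Slot → k[X]}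
    (ha : η Y Y .nil = colHom hi hn Y Y a) (hb : η Z Z .nil = colHom hi hn Z Z b)
    (hc : η Y Z (.cons .nil f) = colHom hi hn Y Z c) :
    natDiffFun _ _ g η Y Z (.cons .nil f) = colHom hi hn Y Z
      (colμ₂ i Y.pos Z.pos Z.pos slotδ c + colμ₂ i Y.pos Y.pos Z.pos (braid₁ i Y.pos Z.pos f) a
        + (g - 1).negOnePow • colComp i Y.pos Z.pos Z.pos b f) := by
  have h0 : ∀ U, (braidFunctor (k := k) hi hn).map (.nil : Quiver.Path U U) = 0 := fun _ => rfl
  have h1 : ∀ U, (incl k (KLRW k n)).map (.nil : Quiver.Path U U) = 0 := fun _ => rfl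
  have h2 : (braidFunctor hi hn).map (Quiver.Path.nil.cons f)
      = slotHom hi hn Y Z (braid₁ i Y.pos Z.pos f) := rfl
  -- One morphism stands to the right of `η`; negating the exponent does not change its parity.
  have h3 : ((g - 1) * -(1 : ℤ)).negOnePow = (g - 1).negOnePow := by
    rw [mul_neg, mul_one, Int.negOnePow_neg]
  simp only [natDiffFun, splits, contractions, h0, h1, List.map_cons, List.map_nil,
    List.nil_append, List.cons_append, List.sum_cons, List.sum_nil, Tw.μ₂_zero_left,
    Tw.μ₂_zero_right, add_zero, zero_add, sub_zero, smul_zero, Quiver.Path.length_nil,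
    Quiver.Path.length_cons, Nat.cast_one, h3]
  have e1 : Tw.μ₂ ((braidFunctor hi hn).map (Quiver.Path.nil.cons f)) (η Y Y .nil)
      = colHom hi hn Y Z (colμ₂ i Y.pos Y.pos Z.pos (braid₁ i Y.pos Z.pos f) a) := by
    rw [ha]; exact μ₂_colHom hi hn Y Y Z _ a
  rw [e1, hb, hc, μ₁_colHom, μ₂_colHom_incl]
  rfl

/-- The inclusion has no second component, so `β²` enters only through its product with `η⁰`. -/
theorem natDiffFun_pair {Y Z W : KLRW k n} (e : Y ⟶ Z) (f : Z ⟶ W) {a b c d : Slot → k[X]}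
    (ha : η Y Y .nil = colHom hi hn Y Y a)
    (hb : η Y Z (.cons .nil e) = colHom hi hn Y Z b)
    (hc : η Z W (.cons .nil f) = colHom hi hn Z W c)
    (hd : η Y W (.cons .nil (e ≫ f)) = colHom hi hn Y W d)
    (h : η Y W ((Quiver.Path.nil.cons e).cons f) = 0) :
    natDiffFun _ _ g η Y W (.cons (.cons .nil e) f) = colHom hi hn Y W
      (colμ₂ i Y.pos Z.pos W.pos (braid₁ i Z.pos W.pos f) b
        + colμ₂ i Y.pos Y.pos W.pos (braid₂ i Y.pos Z.pos W.pos f e) a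
        + (g - 1).negOnePow • colComp i Y.pos Z.pos W.pos c e - (g - 1).negOnePow • d) := by
  have h0 : ∀ U, (braidFunctor (k := k) hi hn).map (.nil : Quiver.Path U U) = 0 := fun _ => rfl
  have h1 : ∀ U, (incl k (KLRW k n)).map (.nil : Quiver.Path U U) = 0 := fun _ => rfl
  have h2 : (incl k (KLRW k n)).map ((Quiver.Path.nil.cons e).cons f) = 0 := rfl
  have h3 : ((g - 1) * -(1 : ℤ)).negOnePow = (g - 1).negOnePow := by
    rw [mul_neg, mul_one, Int.negOnePow_neg]
  simp only [natDiffFun, splits, contractions, h0, h1, h2, h, List.map_cons, List.map_nil,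
    List.nil_append, List.cons_append, List.sum_cons, List.sum_nil,
    Tw.μ₂_zero_right, add_zero, zero_add, smul_zero, Quiver.Path.length_nil,
    Quiver.Path.length_cons, Nat.cast_one, h3, Tw.μ₁_zero, Nat.cast_zero, neg_zero]
  have e1 : Tw.μ₂ ((braidFunctor hi hn).map (Quiver.Path.nil.cons f)) (η Y Z (.cons .nil e))
      = colHom hi hn Y W (colμ₂ i Y.pos Z.pos W.pos (braid₁ i Z.pos W.pos f) b) := by
    rw [hb]; exact μ₂_colHom hi hn Y Z W _ b
  have e2 : Tw.μ₂ ((braidFunctor hi hn).map ((Quiver.Path.nil.cons e).cons f)) (η Y Y .nil)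
      = colHom hi hn Y W (colμ₂ i Y.pos Y.pos W.pos (braid₂ i Y.pos Z.pos W.pos f e) a) := by
    rw [ha]; exact μ₂_colHom hi hn Y Y W _ a
  rw [e1, e2, hc, hd, μ₂_colHom_incl]
  exact colHom_combine hi hn Y W _ _ _ _ _

/-- By length, the only product that could survive is `β²` after `η¹` on a chain of three morphisms.
It vanishes because `η¹` takes values in the summand `T_i` of `β T_i`, while `β²` out of `β T_i` is
supported on the other two summands. -/
theorem natDiffFun_long (h : ∀ {Y Z : KLRW k n} (p : Quiver.Path Y Z), 2 ≤ p.length → η Y Z p = 0)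
    (h' : ∀ {Y Z : KLRW k n} (f : Y ⟶ Z) (t : ((braidFunctor hi hn).obj Z).ι),
      (t.1 ≠ .main ∨ Z.pos ≠ i) → η Y Z (.cons .nil f) () t = 0)
    {Y Z : KLRW k n} (p : Quiver.Path Y Z) (hp : 3 ≤ p.length) :
    natDiffFun _ _ g η Y Z p = 0 := by
  unfold natDiffFun
  rw [h p (by omega), Tw.μ₁_zero, zero_add, List.sum_eq_zero, List.sum_eq_zero,
    List.sum_eq_zero, add_zero, sub_zero]
  · intro x hx
    obtain ⟨c, hc, rfl⟩ := List.mem_map.1 hx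
    have := length_of_mem_contractions _ c hc
    rw [h _ (by omega), smul_zero]
  · intro x hx
    obtain ⟨⟨W, q, r⟩, hs, rfl⟩ := List.mem_map.1 hx
    have := length_of_mem_splits _ _ hs
    simp only at this ⊢
    by_cases hq : q.length = 1
    · rw [h r (by omega), Tw.μ₂_zero_left, smul_zero]
    · rw [show (incl k (KLRW k n)).map q = 0 from inclMap_eq_zero q hq, Tw.μ₂_zero_right,
        smul_zero]
  · intro x hx
    obtain ⟨⟨W, q, r⟩, hs, rfl⟩ := List.mem_map.1 hx
    have := length_of_mem_splits _ _ hs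
    simp only at this ⊢
    clear hs hx
    by_cases hq : 2 ≤ q.length
    · rw [h q hq, Tw.μ₂_zero_right]
    by_cases hr : 3 ≤ r.length
    · rw [show (braidFunctor hi hn).map r = 0 from braidMap_eq_zero hi hn r (Or.inr hr),
        Tw.μ₂_zero_left]
    match q, r with
    | .cons .nil e, .cons (.cons (c := V) .nil f) l =>
      have e1 := μ₂_colHom hi hn Y W Z (braid₂ i W.pos V.pos Z.pos l f)
        (col hi hn (η Y W (.cons .nil e)))
      rw [colHom_col] at e1
      refine e1.trans (((colHom_eq_iff hi hn (ψ := 0)).2 fun t ht => ?_).trans rfl)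
      have hc : ∀ t : Slot, t ≠ .main ∨ W.pos ≠ i →
          col hi hn (η Y W (.cons .nil e)) t = 0 := by
        intro t ht
        unfold col
        split_ifs with ht'
        exacts [h' e ⟨t, ht'⟩ ht, rfl]
      have hl := hc .left (Or.inl (by simp))
      have hr := hc .right (Or.inl (by simp))
      simp only [colμ₂, hl, hr]
      by_cases hW : W.pos = i
      · have hm : braid₂ i W.pos V.pos Z.pos l f .main t = 0 := by
          unfold braid₂
          split_ifs <;> cases t <;> first | rfl | simp_all
        simp [hm]
      · simp [hc .main (Or.inr hW), hW]
    | .nil, _ => simp at this; omega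
    | .cons (.cons _ _) _, _ => simp at hq
    | _, .nil => simp at this; omega
    | .cons .nil _, .cons .nil _ => simp at this; omega
    | _, .cons (.cons (.cons _ _) _) _ => simp at hr

end BraidNat
section BraidNat

variable {k : Type u} [Field k] {n : ℕ} {i : ℕ} {hi : 0 < i} {hn : i < n}

/-! ### Values of the crossing exponent -/

theorem crossing_self_left (x y : ℤ) : crossing x x y = 0 := by
  have := crossing_eq x x y
  simp at this
  exact this

theorem crossing_self_right (x y : ℤ) : crossing x y y = 0 := by
  have := crossing_eq x y y
  simp at this
  exact this

/-- The exponent is half the defect in the triangle inequality, so each value below is linear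
arithmetic with absolute values. -/
theorem crossing_eq_of {x y z : ℤ} (m : ℕ) (h : |x - y| + |y - z| - |x - z| = 2 * m) :
    crossing x y z = m := by
  have := crossing_eq x y z
  omega

theorem crossing_pred_of_lt {x y : ℤ} (h : x < y) : crossing x y (y - 1) = 1 :=
  crossing_eq_of 1 (by simp only [abs_eq_max_neg]; omega)

theorem crossing_succ_of_lt {x y : ℤ} (h : x < y) : crossing x y (y + 1) = 0 :=
  crossing_eq_of 0 (by simp only [abs_eq_max_neg]; omega)

theorem crossing_pred_of_gt {x y : ℤ} (h : y < x) : crossing x y (y - 1) = 0 :=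
  crossing_eq_of 0 (by simp only [abs_eq_max_neg]; omega)

theorem crossing_succ_of_gt {x y : ℤ} (h : y < x) : crossing x y (y + 1) = 1 :=
  crossing_eq_of 1 (by simp only [abs_eq_max_neg]; omega)

theorem pred_crossing_of_lt {x y : ℤ} (h : y < x) : crossing x (x - 1) y = 0 :=
  crossing_eq_of 0 (by simp only [abs_eq_max_neg]; omega)

theorem succ_crossing_of_lt {x y : ℤ} (h : y < x) : crossing x (x + 1) y = 1 :=
  crossing_eq_of 1 (by simp only [abs_eq_max_neg]; omega)

theorem pred_crossing_of_gt {x y : ℤ} (h : x < y) : crossing x (x - 1) y = 1 :=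
  crossing_eq_of 1 (by simp only [abs_eq_max_neg]; omega)

theorem succ_crossing_of_gt {x y : ℤ} (h : x < y) : crossing x (x + 1) y = 0 :=
  crossing_eq_of 0 (by simp only [abs_eq_max_neg]; omega)

/-! ### The transformations `η_ε` -/

/-- The polynomial `∑ ½ ε_ℓ s^{ℓ-1}`. -/
noncomputable def halfSum (ε : ℕ+ →₀ k) : k[X] :=
  ε.sum fun ℓ c => monomial ((ℓ : ℕ) - 1) (c / 2)

/-- The index shift `ℓ = m + 1` identifies sequences starting at `1` with polynomials; injectivity
and surjectivity of `halfSum` are read off from it. -/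
theorem coeff_halfSum (ε : ℕ+ →₀ k) (m : ℕ) :
    (halfSum ε).coeff m = ε m.succPNat / 2 := by
  unfold halfSum Finsupp.sum
  rw [finsetSum_coeff]
  simp only [coeff_monomial]
  rw [Finset.sum_eq_single m.succPNat]
  · simp
  · intro ℓ _ h
    refine if_neg fun h' => h ?_
    apply PNat.coe_injective
    have := ℓ.pos
    simp only [Nat.succPNat_coe]
    omega
  · intro h
    simp [Finsupp.notMem_support_iff.1 h]

theorem sum_monomial_eq (h2 : (2 : k) ≠ 0) (ε : ℕ+ →₀ k) :
    (ε.sum fun ℓ c => monomial (ℓ : ℕ) c : k[X]) = X * (halfSum ε + halfSum ε) := by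
  unfold halfSum
  rw [← Finsupp.sum_add, Finsupp.mul_sum]
  refine Finsupp.sum_congr fun ℓ _ => ?_
  -- The truncated exponent `ℓ - 1` is harmless because `ℓ ≥ 1`.
  rw [← map_add, X_mul_monomial, ← mul_two, div_mul_cancel₀ _ h2, Nat.sub_add_cancel ℓ.pos]

theorem halfSum_add (ε ε' : ℕ+ →₀ k) : halfSum (ε + ε') = halfSum ε + halfSum ε' := by
  ext m
  simp [coeff_halfSum, add_div]

theorem halfSum_smul (r : k) (ε : ℕ+ →₀ k) : halfSum (r • ε) = r • halfSum ε := by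
  ext m
  simp [coeff_halfSum, mul_div_assoc]

theorem eq_zero_of_halfSum_eq_zero (h2 : (2 : k) ≠ 0) {ε : ℕ+ →₀ k} (h : halfSum ε = 0) :
    ε = 0 := by
  ext ℓ
  have := coeff_halfSum ε ℓ.natPred
  rw [h, coeff_zero, PNat.succPNat_natPred] at this
  simpa [h2] using this.symm

theorem exists_halfSum_eq (h2 : (2 : k) ≠ 0) (p : k[X]) : ∃ ε : ℕ+ →₀ k, halfSum ε = p := by
  classical
  -- The coefficient formula forces `ε_ℓ = 2 p_{ℓ-1}`.
  refine ⟨Finsupp.onFinset (p.support.image Nat.succPNat) (fun ℓ => p.coeff ℓ.natPred * 2)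
    fun ℓ h => Finset.mem_image.2 ⟨ℓ.natPred, ?_, PNat.succPNat_natPred ℓ⟩, ?_⟩
  · exact mem_support_iff.2 (left_ne_zero_of_mul h)
  · ext m
    rw [coeff_halfSum, Finsupp.onFinset_apply, Nat.natPred_succPNat, mul_div_cancel_right₀ _ h2]

variable (i) in
/-- The entries of `η⁰(T_x)`, where `p` is the polynomial `∑ ½ ε_ℓ s^{ℓ-1}`. -/
noncomputable def natCol₀ (p : k[X]) (x : ℤ) : Slot → k[X]
  | .main => if x = i then 0 else X * (p + p)
  | _ => p

variable (i) in
/-- The entries of `η¹(a_{yx}f(s))`, where `p` is the polynomial `∑ ½ ε_ℓ s^{ℓ-1}`. -/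
noncomputable def natCol₁ (p : k[X]) (x y : ℤ) (f : k[X]) : Slot → k[X]
  | .main => if y = i then (i - x : ℤ).sign • (p * f) else 0
  | _ => 0

variable (hi hn)

theorem braidNat_nil (h2 : (2 : k) ≠ 0) (ε : ℕ+ →₀ k) (Y : KLRW k n) :
    braidNat hi hn ε Y Y .nil = colHom hi hn Y Y (natCol₀ i (halfSum ε) Y.pos) := by
  funext a ⟨t, ht⟩
  cases t
  · refine Eq.trans ?_ (congrArg (fun q : k[X] => if Y.pos = i then 0 else q)
      (sum_monomial_eq h2 ε))
    rfl
  · rfl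
  · rfl

theorem braidNat_single (ε : ℕ+ →₀ k) {Y Z : KLRW k n} (f : Y ⟶ Z) :
    braidNat hi hn ε Y Z (.cons .nil f) = colHom hi hn Y Z (natCol₁ i (halfSum ε) Y.pos Z.pos f) := by
  funext a ⟨t, ht⟩
  cases t
  · have h : ∀ q : k[X], (ε.sum fun ℓ c => monomial ((ℓ : ℕ) - 1) (c / 2) * q) = halfSum ε * q :=
      fun q => (Finsupp.sum_mul q ε).symm
    refine Eq.trans ?_ (congrArg
      (fun q : k[X] => if Z.pos = i then (i - Y.pos : ℤ).sign • q else 0) (h f))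
    rfl
  · rfl
  · rfl

theorem braidNat_eq_zero (ε : ℕ+ →₀ k) {Y Z : KLRW k n} (p : Quiver.Path Y Z)
    (hp : 2 ≤ p.length) : braidNat hi hn ε Y Z p = 0 := by
  match p, hp with
  | .nil, h => simp at h
  | .cons .nil f, h => simp at h
  | .cons (.cons _ _) _, _ => rfl

/-! ### The cocycle property of `η_ε` -/

theorem braidNat_mem_preNat (h2 : (2 : k) ≠ 0) (ε : ℕ+ →₀ k) :
    braidNat hi hn ε ∈ preNat (incl k (KLRW k n)) (braidFunctor hi hn) 0 := by
  refine ⟨fun {Y Z U W} p q => ?_, fun {Y Z} p => ?_⟩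
  · match p, q with
    | .nil, .nil =>
      have h : ∀ f : Y ⟶ U, braidNat hi hn ε Y U ((Quiver.Path.nil.cons f).comp .nil) = _ :=
        braidNat_single hi hn ε
      simp only [h]
      constructor
      · intro f f'
        funext a ⟨t, ht⟩
        cases t
        · change (if U.pos = i then (i - Y.pos : ℤ).sign • (halfSum ε * (_ + _)) else 0 : k[X])
            = (if U.pos = i then _ else 0) + (if U.pos = i then _ else 0)
          split_ifs
          · rw [mul_add, smul_add]
          · rw [add_zero]
        · exact (add_zero (0 : k[X])).symm
        · exact (add_zero (0 : k[X])).symm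
      · intro r f
        funext a ⟨t, ht⟩
        cases t
        · change (if U.pos = i then (i - Y.pos : ℤ).sign • (halfSum ε * (r • _)) else 0 : k[X])
            = r • (if U.pos = i then _ else 0)
          split_ifs
          · rw [mul_smul_comm, smul_comm]
          · rw [smul_zero]
        · exact (smul_zero (A := k[X]) r).symm
        · exact (smul_zero (A := k[X]) r).symm
    | .cons p a, q =>
      have : ∀ f : Z ⟶ U, braidNat hi hn ε Y W (((p.cons a).cons f).comp q) = 0 :=
        fun f => braidNat_eq_zero hi hn ε _ (by simp; omega)
      simp only [this]
      exact ⟨by simp, by simp⟩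
    | p, .cons q a =>
      have : ∀ f : Z ⟶ U, braidNat hi hn ε Y _ ((p.cons f).comp (q.cons a)) = 0 :=
        fun f => braidNat_eq_zero hi hn ε _ (by simp; omega)
      simp only [this]
      exact ⟨by simp, by simp⟩
  · match p with
    | .nil =>
      rintro a ⟨t, ht⟩ h
      rw [braidNat_nil hi hn h2]
      have h' : slotDeg i Y.pos t ≠ 0 := h
      cases t <;> simp [slotDeg] at h'
      exact if_pos h'
    | .cons .nil f =>
      rintro a ⟨t, ht⟩ h
      rw [braidNat_single]
      have h' : slotDeg i Z.pos t ≠ -1 := h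
      cases t <;> simp [slotDeg] at h'
      · exact if_neg h'
      · rfl
      · rfl
    | .cons (.cons _ _) _ => intro a b _; rfl

/-- Out of `T_i`, the routes through `T_{i-1}` and `T_{i+1}` each contribute `s p f`, matching `η⁰ =
2 s p` at the target. Into `T_i`, the term `δ η¹` accounts for the difference between `β¹(f)`, which
sees one neighbour, and `η⁰(T_i)`, which sees both. -/
theorem braidNat_rel_single (p f : k[X]) (x y : ℤ) (t : Slot) (ht : t = .main ∨ y = i) :
    (colμ₂ i x y y slotδ (natCol₁ i p x y f)
      + colμ₂ i x x y (braid₁ i x y f) (natCol₀ i p x)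
      + (-1 : ℤˣ) • colComp i x y y (natCol₀ i p y) f) t = 0 := by
  simp only [Pi.add_apply, Pi.smul_apply, colμ₂, colComp]
  rcases vertex_cases x i with ⟨x1, x2, x3⟩ | rfl | ⟨x1, x2, x3⟩ <;>
  rcases slot_cases ht with ⟨y1, y2, y3, rfl⟩ | ⟨rfl, rfl⟩ | ⟨rfl, rfl⟩ | ⟨rfl, rfl⟩ |
    ⟨y1, y2, y3, rfl⟩ <;>
  -- The sign of `i - x` is fixed by the case; for `x = i` it is left to `simp`, which evaluates it
  -- to `0`.
  first
  | have hsg : ((i : ℤ) - x).sign = 1 := Int.sign_eq_one_of_pos (by omega)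
  | have hsg : ((i : ℤ) - x).sign = -1 := Int.sign_eq_neg_one_of_neg (by omega)
  | skip
  all_goals
    simp [natCol₀, natCol₁, slotPos, slotDeg, slotδ, braid₁, crossing_self_left, crossing_self_right,
      crossing_pred_of_lt, crossing_succ_of_lt, crossing_pred_of_gt, crossing_succ_of_gt,
      pred_crossing_of_lt, succ_crossing_of_lt, pred_crossing_of_gt, succ_crossing_of_gt, *]
  all_goals ring

/-- Only `z = i` matters. If `x` and `y` lie on the same side of `i`, the two `η¹` terms cancel. On
opposite sides their signs agree and they add up to twice one term, which `β²` applied to `η⁰ = 2 s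
p` cancels. For `x = i ≠ y`, the sign in `η¹` of the composite is `0`, and `β²` picks one of the two
entries `p` of `η⁰(T_i)`. -/
theorem braidNat_rel_pair (p e f : k[X]) (x y z : ℤ) (t : Slot) (ht : t = .main ∨ z = i) :
    (colμ₂ i x y z (braid₁ i y z f) (natCol₁ i p x y e)
      + colμ₂ i x x z (braid₂ i x y z f e) (natCol₀ i p x)
      + (-1 : ℤˣ) • colComp i x y z (natCol₁ i p y z f) e
      - (-1 : ℤˣ) • (natCol₁ i p x z (e * f * X ^ crossing x y z))) t = 0 := by
  simp only [Pi.add_apply, Pi.sub_apply, Pi.smul_apply, colμ₂, colComp]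
  rcases vertex_cases x i with ⟨x1, x2, x3⟩ | rfl | ⟨x1, x2, x3⟩ <;>
  rcases vertex_cases y i with ⟨y1, y2, y3⟩ | rfl | ⟨y1, y2, y3⟩ <;>
  rcases slot_cases ht with ⟨z1, z2, z3, rfl⟩ | ⟨rfl, rfl⟩ | ⟨rfl, rfl⟩ | ⟨rfl, rfl⟩ |
    ⟨z1, z2, z3, rfl⟩ <;>
  first
  | have hsg : ((i : ℤ) - x).sign = 1 := Int.sign_eq_one_of_pos (by omega)
  | have hsg : ((i : ℤ) - x).sign = -1 := Int.sign_eq_neg_one_of_neg (by omega)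
  | skip
  all_goals
  first
  | have hsg : ((i : ℤ) - y).sign = 1 := Int.sign_eq_one_of_pos (by omega)
  | have hsg : ((i : ℤ) - y).sign = -1 := Int.sign_eq_neg_one_of_neg (by omega)
  | skip
  all_goals
    simp [natCol₀, natCol₁, slotPos, slotDeg, braid₁, braid₂, crossing_self_left, crossing_self_right,
      mul_neg_iff, *]
  all_goals
    first
    | ring1
    | (obtain ⟨m, hm⟩ : ∃ m, ((i : ℤ) - y).natAbs = m + 1 :=
        Nat.exists_eq_succ_of_ne_zero (by omega)
       have hc : crossing x y i = m + 1 :=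
        crossing_eq_of (m + 1) (by simp only [abs_eq_max_neg]; omega)
       rw [hm, hc, Nat.add_sub_cancel]
       ring1)
    | (obtain ⟨m, hm⟩ : ∃ m, ((i : ℤ) - y).natAbs = m + 1 :=
        Nat.exists_eq_succ_of_ne_zero (by omega)
       have hc : crossing i y i = m + 1 :=
        crossing_eq_of (m + 1) (by simp only [abs_eq_max_neg]; omega)
       first
       | rw [hm, hc, crossing_eq_of 1 (by simp only [abs_eq_max_neg]; omega :
          |(i : ℤ) - (i - 1)| + |(i : ℤ) - 1 - i| - |(i : ℤ) - i| = 2 * (1 : ℕ)),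
          Nat.add_sub_cancel]
       | rw [hm, hc, crossing_eq_of 1 (by simp only [abs_eq_max_neg]; omega :
          |(i : ℤ) - (i + 1)| + |(i : ℤ) + 1 - i| - |(i : ℤ) - i| = 2 * (1 : ℕ)),
          Nat.add_sub_cancel]
       ring1)

theorem braidNat_mem_ker (h2 : (2 : k) ≠ 0) (ε : ℕ+ →₀ k) :
    natDiffFun (incl k (KLRW k n)) (braidFunctor hi hn) 0 (braidNat hi hn ε) = 0 := by
  -- In degree `g = 0` the sign `(-1)^{g-1}` is `-1`.
  have hu : ((0 : ℤ) - 1).negOnePow = -1 := by decide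
  funext Y Z p
  match p with
  | .nil =>
    rw [natDiffFun_nil 0 (braidNat_nil hi hn h2 ε Y)]
    refine (colHom_eq_iff hi hn (ψ := 0)).2 fun t ht => ?_
    by_cases hY : Y.pos = i <;> cases t <;> simp_all [colμ₂, slotδ, natCol₀]
  | .cons .nil f =>
    rw [natDiffFun_single 0 f (braidNat_nil hi hn h2 ε Y) (braidNat_nil hi hn h2 ε Z)
      (braidNat_single hi hn ε f)]
    refine (colHom_eq_iff hi hn (ψ := 0)).2 fun t ht => ?_
    rw [hu]
    exact braidNat_rel_single (halfSum ε) f Y.pos Z.pos t ht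
  | .cons (.cons (c := V) .nil e) f =>
    rw [natDiffFun_pair 0 e f (braidNat_nil hi hn h2 ε Y) (braidNat_single hi hn ε e)
      (braidNat_single hi hn ε f) (braidNat_single hi hn ε (e ≫ f)) rfl]
    refine (colHom_eq_iff hi hn (ψ := 0)).2 fun t ht => ?_
    rw [hu]
    exact braidNat_rel_pair (halfSum ε) e f Y.pos V.pos Z.pos t ht
  | .cons (.cons (.cons _ _) _) _ =>
    refine natDiffFun_long 0 (fun p hp => braidNat_eq_zero hi hn ε p hp) (fun f t ht => ?_) _
      (by simp)
    rw [braidNat_single]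
    obtain ⟨t, ht'⟩ := t
    cases t
    · exact if_neg (by simpa using ht)
    · rfl
    · rfl

end BraidNat
theorem KLRW.exists_pos_eq {k : Type u} {i n : ℕ} (hn : i < n) : ∃ Y : KLRW k n, Y.pos = i :=
  ⟨⟨⟨i, by omega⟩⟩, rfl⟩

theorem KLRW.pos_injective {k : Type u} {n : ℕ} : Function.Injective (pos (k := k) (n := n)) := by
  rintro ⟨y⟩ ⟨z⟩ h
  simp only [KLRW.pos, Nat.cast_inj] at h
  rw [Fin.ext h]

section BraidNat

variable {k : Type u} [Field k] {n : ℕ} {i : ℕ} {hi : 0 < i} {hn : i < n}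

/-! ### Natural transformations up to coboundaries -/

theorem col_colHom {Y Z : KLRW k n} (φ : Slot → k[X]) {t : Slot} (ht : t = .main ∨ Z.pos = i) :
    col hi hn (colHom hi hn Y Z φ) t = φ t :=
  col_apply hi hn _ ht

section

variable {η : Family (incl k (KLRW k n)) (braidFunctor hi hn)}

/-- A component on `d ≥ 2` morphisms would have degree `-d`, below every summand. -/
theorem eq_zero_of_two_le (hη : η ∈ preNat _ _ 0) {Y Z : KLRW k n} (p : Quiver.Path Y Z)
    (hp : 2 ≤ p.length) : η Y Z p = 0 := by
  funext a ⟨t, ht⟩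
  refine hη.2 p a ⟨t, ht⟩ ?_
  change slotDeg i Z.pos t ≠ 0 + (0 - (p.length : ℤ))
  cases t <;> simp only [slotDeg] <;> (try split_ifs) <;> omega

theorem col_nil_main (hη : η ∈ preNat _ _ 0) {Y : KLRW k n} (hY : Y.pos = i) :
    col hi hn (η Y Y .nil) .main = 0 := by
  rw [col_apply _ _ _ (Or.inl rfl)]
  refine hη.2 .nil () ⟨.main, _⟩ ?_
  change slotDeg i Y.pos .main ≠ 0 + (0 - ((0 : ℕ) : ℤ))
  simp [slotDeg, hY]

theorem col_single_eq_zero (hη : η ∈ preNat _ _ 0) {Y Z : KLRW k n} (f : Y ⟶ Z) {t : Slot}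
    (ht : t = .main ∨ Z.pos = i) (h : t ≠ .main ∨ Z.pos ≠ i) :
    col hi hn (η Y Z (.cons .nil f)) t = 0 := by
  rw [col_apply _ _ _ ht]
  refine hη.2 (.cons .nil f) () ⟨t, ht⟩ ?_
  change slotDeg i Z.pos t ≠ 0 + (0 - ((1 : ℕ) : ℤ))
  cases t <;> simp_all [slotDeg]

/-- The cocycle equation on a morphism. -/
theorem natTrans_rel (hη : η ∈ natTrans _ _ 0) {Y Z : KLRW k n} (f : Y ⟶ Z) (t : Slot)
    (ht : t = .main ∨ Z.pos = i) :
    colμ₂ i Y.pos Z.pos Z.pos slotδ (col hi hn (η Y Z (.cons .nil f))) t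
      + colμ₂ i Y.pos Y.pos Z.pos (braid₁ i Y.pos Z.pos f) (col hi hn (η Y Y .nil)) t
      - colComp i Y.pos Z.pos Z.pos (col hi hn (η Z Z .nil)) f t = 0 := by
  have hu : ((0 : ℤ) - 1).negOnePow = -1 := by decide
  have h : natDiffFun _ _ 0 η Y Z (.cons .nil f) = 0 :=
    congrFun (congrFun (congrFun (LinearMap.mem_ker.1 hη.2) Y) Z) _
  rw [natDiffFun_single 0 f (colHom_col hi hn _).symm (colHom_col hi hn _).symm
    (colHom_col hi hn _).symm, hu] at h
  have h' := (colHom_eq_iff hi hn (ψ := 0)).1 h t ht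
  simpa [sub_eq_add_neg] using h'

/-- From the left, `β¹(f)` has no entry into `T_{i+1}`, so there `δ η¹(f)` alone must balance
`η⁰(T_i) f`. No power of `s` appears since the path is monotone. -/
theorem col_single_main_of_lt (hη : η ∈ natTrans _ _ 0) {Y Z : KLRW k n} (hZ : Z.pos = i)
    (hY : Y.pos < i) (f : Y ⟶ Z) :
    col hi hn (η Y Z (.cons .nil f)) .main = HMul.hMul (α := k[X]) f
      (col hi hn (η Z Z .nil) .right) := by
  have h := natTrans_rel hη f .right (Or.inr hZ)
  simp [colμ₂, colComp, slotδ, slotDeg, slotPos, braid₁, crossing_succ_of_lt hY, hZ, hY.ne,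
    hY.not_gt] at h
  exact sub_eq_zero.1 h

theorem col_single_main_of_gt (hη : η ∈ natTrans _ _ 0) {Y Z : KLRW k n} (hZ : Z.pos = i)
    (hY : i < Y.pos) (f : Y ⟶ Z) :
    col hi hn (η Y Z (.cons .nil f)) .main = -(HMul.hMul (α := k[X]) f
      (col hi hn (η Z Z .nil) .left)) := by
  have h := natTrans_rel hη f .left (Or.inr hZ)
  simp [colμ₂, colComp, slotδ, slotDeg, slotPos, braid₁, crossing_pred_of_gt hY, hZ, hY.ne',
    hY.not_gt] at h
  linear_combination -h

/-- An endomorphism of `T_i` acts on `β T_i` by scalar multiplication, which already commutes with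
`η⁰(T_i)`. -/
theorem col_single_main_of_eq (hη : η ∈ natTrans _ _ 0) {Y Z : KLRW k n} (hZ : Z.pos = i)
    (hY : Y.pos = i) (f : Y ⟶ Z) :
    col hi hn (η Y Z (.cons .nil f)) .main = 0 := by
  obtain rfl : Y = Z := KLRW.pos_injective (hY.trans hZ.symm)
  have h := natTrans_rel hη f .left (Or.inr hZ)
  simp [colμ₂, colComp, slotδ, slotDeg, slotPos, braid₁, crossing_self_left, crossing_self_right,
    hZ] at h
  linear_combination -h

/-- The equation is read at the neighbour of `T_i` on the side of `Y`, the one not used to find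
`η¹`. Passing through `T_i` and back creates the factor `X`. -/
theorem col_nil_main_of_ne (hη : η ∈ natTrans _ _ 0) {Y Z : KLRW k n} (hZ : Z.pos = i)
    (hY : Y.pos ≠ i) :
    col hi hn (η Y Y .nil) .main
      = X * (col hi hn (η Z Z .nil) .left + col hi hn (η Z Z .nil) .right) := by
  -- The generator `a_{ij}s⁰` is enough, where `j` is the index of `Y`.
  let f : Y ⟶ Z := (1 : k[X])
  rcases lt_or_gt_of_ne hY with hY' | hY'
  · have h := natTrans_rel hη f .left (Or.inr hZ)
    have h' := col_single_main_of_lt hη hZ hY' f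
    simp [colμ₂, colComp, slotδ, slotDeg, slotPos, braid₁, crossing_pred_of_lt hY', hZ, hY,
      hY', crossing_self_left, h', f] at h
    linear_combination h
  · have h := natTrans_rel hη f .right (Or.inr hZ)
    have h' := col_single_main_of_gt hη hZ hY' f
    simp [colμ₂, colComp, slotδ, slotDeg, slotPos, braid₁, crossing_succ_of_gt hY', hZ, hY,
      hY', crossing_self_left, h', f] at h
    linear_combination h

end

/-! ### Coboundaries -/

/-- The family of degree `-1` with a single component `η⁰(T_i) = p`. -/
noncomputable def pointFamily (hi : 0 < i) (hn : i < n) (p : k[X]) :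
    Family (incl k (KLRW k n)) (braidFunctor hi hn)
  | Y, _, .nil => colHom hi hn Y Y (fun t => if t = .main ∧ Y.pos = i then p else 0)
  | _, _, .cons _ _ => 0

theorem pointFamily_nil (p : k[X]) (Y : KLRW k n) :
    pointFamily hi hn p Y Y .nil
      = colHom hi hn Y Y (fun t => if t = .main ∧ Y.pos = i then p else 0) :=
  rfl

theorem pointFamily_single (p : k[X]) {Y Z : KLRW k n} (f : Y ⟶ Z) :
    pointFamily hi hn p Y Z (.cons .nil f) = colHom hi hn Y Z 0 :=
  rfl

theorem pointFamily_eq_zero (p : k[X]) {Y Z : KLRW k n} (q : Quiver.Path Y Z)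
    (hq : 1 ≤ q.length) : pointFamily hi hn p Y Z q = 0 := by
  match q, hq with
  | .nil, h => simp at h
  | .cons _ _, _ => rfl

theorem pointFamily_mem_preNat (p : k[X]) :
    pointFamily hi hn p ∈ preNat (incl k (KLRW k n)) (braidFunctor hi hn) (0 - 1) := by
  refine ⟨fun {Y Z U W} q r => ?_, fun {Y Z} q => ?_⟩
  · have : ∀ f : Z ⟶ U, pointFamily hi hn p Y W ((q.cons f).comp r) = 0 :=
      fun f => pointFamily_eq_zero p _ (by simp; omega)
    simp only [this]
    exact ⟨by simp, by simp⟩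
  · match q with
    | .nil =>
      rintro a ⟨t, ht⟩ h
      have h' : slotDeg i Y.pos t ≠ 0 + (0 - 1 - ((0 : ℕ) : ℤ)) := h
      refine if_neg ?_
      rintro ⟨h1, h2⟩
      obtain rfl : t = .main := h1
      simp [slotDeg, h2] at h'
    | .cons _ _ => intro a b _; rfl

/-- The only candidate is `β²` applied to the summand `T_i` of `β T_i`, on which `β²` vanishes. -/
theorem natDiffFun_pointFamily (p : k[X]) {Y Z : KLRW k n} (q : Quiver.Path Y Z)
    (hq : 2 ≤ q.length) :
    natDiffFun (incl k (KLRW k n)) (braidFunctor hi hn) (0 - 1) (pointFamily hi hn p) Y Z q = 0 := by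
  match q, hq with
  | .nil, h => simp at h
  | .cons .nil f, h => simp at h
  | .cons (.cons (c := V) .nil e) f, _ =>
    rw [natDiffFun_pair (0 - 1) e f (pointFamily_nil p Y) (pointFamily_single p e)
      (pointFamily_single p f) (pointFamily_single p (e ≫ f)) rfl]
    refine (colHom_eq_iff hi hn (ψ := 0)).2 fun t ht => ?_
    by_cases hY : Y.pos = i
    · have hm : braid₂ i Y.pos V.pos Z.pos f e .main t = 0 := by
        unfold braid₂
        split_ifs <;> cases t <;> first | rfl | simp_all
      simp [colμ₂, colComp, hm]
    · simp [colμ₂, colComp, hY]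
  | .cons (.cons (.cons _ _) _) _, _ =>
    exact natDiffFun_long (0 - 1) (fun q hq => pointFamily_eq_zero p q (by omega))
      (fun f t _ => rfl) _ (by simp)

/-- If `R = -L`, then `η⁰(T_j) = 0` for `j ≠ i` and `η¹(f) = -f L` for every `f : T_j ⟶ T_i` with `j
≠ i`, on either side: the differential of a single polynomial at `T_i`. -/
theorem mem_coboundaries {η : Family (incl k (KLRW k n)) (braidFunctor hi hn)}
    (hη : η ∈ natTrans _ _ 0)
    (h : ∀ Y : KLRW k n, Y.pos = i →
      col hi hn (η Y Y .nil) .left + col hi hn (η Y Y .nil) .right = 0) :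
    η ∈ coboundaries (incl k (KLRW k n)) (braidFunctor hi hn) 0 := by
  have hu : ((0 : ℤ) - 1 - 1).negOnePow = 1 := by decide
  obtain ⟨T, hT⟩ := KLRW.exists_pos_eq (k := k) hn
  have hr : col hi hn (η T T .nil) .right = -col hi hn (η T T .nil) .left := by
    linear_combination h T hT
  set p := col hi hn (η T T .nil) .left with hp
  -- The sign compensates for `μ¹`, which is `-δ` on morphisms of degree `-1`.
  refine ⟨pointFamily hi hn (-p), pointFamily_mem_preNat _, ?_⟩
  funext Y Z q
  change natDiffFun _ _ (0 - 1) (pointFamily hi hn (-p)) Y Z q = _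
  match q with
  | .nil =>
    rw [natDiffFun_nil (0 - 1) (pointFamily_nil _ Y), ← colHom_col hi hn (η Y Y .nil)]
    refine (colHom_eq_iff hi hn).2 fun t ht => ?_
    by_cases hY : Y.pos = i
    · obtain rfl : Y = T := KLRW.pos_injective (hY.trans hT.symm)
      cases t
      · simp [colμ₂, slotδ, col_nil_main hη.1 hY]
      · simp [colμ₂, slotδ, slotDeg, slotPos, crossing_self_left, hY, ← hp]
      · simp [colμ₂, slotδ, slotDeg, slotPos, crossing_self_left, hY, hr]
    · obtain rfl : t = .main := ht.resolve_right hY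
      rw [col_nil_main_of_ne hη hT hY, h T hT]
      simp [colμ₂, hY]
  | .cons .nil f =>
    rw [natDiffFun_single (0 - 1) f (pointFamily_nil _ Y) (pointFamily_nil _ Z) (pointFamily_single _ f),
      ← colHom_col hi hn (η Y Z (.cons .nil f)), hu]
    refine (colHom_eq_iff hi hn).2 fun t ht => ?_
    by_cases ht' : t = .main ∧ Z.pos = i
    · obtain ⟨rfl, hZ⟩ := ht'
      obtain rfl : Z = T := KLRW.pos_injective (hZ.trans hT.symm)
      rcases vertex_cases Y.pos i with ⟨hY, hY1, hY2⟩ | hY | ⟨hY, hY1, hY2⟩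
      · rw [col_single_main_of_lt hη hZ hY, hr]
        simp [colμ₂, colComp, slotPos, crossing_self_right, hZ, hY1]
      · rw [col_single_main_of_eq hη hZ hY]
        simp [colμ₂, colComp, slotPos, slotDeg, braid₁, crossing_self_right, hZ, hY]
        ring
      · rw [col_single_main_of_gt hη hZ hY]
        simp [colμ₂, colComp, slotPos, crossing_self_right, hZ, hY1, ← hp]
    · rw [col_single_eq_zero hη.1 f ht (not_and_or.1 ht')]
      by_cases hY : Y.pos = i
      · have hm : braid₁ i Y.pos Z.pos f .main t = 0 := by
          unfold braid₁
          split_ifs <;> cases t <;> first | rfl | simp_all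
        simp [colμ₂, colComp, hm, ht']
      · simp [colμ₂, colComp, hY, ht']
  | .cons (.cons q e) f =>
    rw [eq_zero_of_two_le hη.1 _ (by simp), natDiffFun_pointFamily _ _ (by simp)]

/-- The two entries of the bounding cochain of `β T_i` are `1` and `-1`. -/
theorem col_add_col_of_mem_coboundaries {η : Family (incl k (KLRW k n)) (braidFunctor hi hn)}
    (hη : η ∈ coboundaries (incl k (KLRW k n)) (braidFunctor hi hn) 0) {Y : KLRW k n}
    (hY : Y.pos = i) :
    col hi hn (η Y Y .nil) .left + col hi hn (η Y Y .nil) .right = 0 := by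
  obtain ⟨θ, -, rfl⟩ := hη
  have h : natDiff _ _ (0 - 1) θ Y Y .nil = colHom hi hn Y Y _ :=
    natDiffFun_nil (0 - 1) (colHom_col hi hn _).symm
  rw [h, col_colHom _ (Or.inr hY), col_colHom _ (Or.inr hY)]
  simp [colμ₂, slotδ, slotDeg, slotPos, crossing_self_left, hY]

/-! ### The isomorphism with the cohomology -/

variable (hi hn) in
/-- The map `ε ↦ η_ε`. -/
noncomputable def braidNatTrans (h2 : (2 : k) ≠ 0) :
    (ℕ+ →₀ k) →ₗ[k] natTrans (incl k (KLRW k n)) (braidFunctor hi hn) 0 where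
  toFun ε := ⟨braidNat hi hn ε, braidNat_mem_preNat hi hn h2 ε, braidNat_mem_ker hi hn h2 ε⟩
  map_add' ε ε' := by
    refine Subtype.ext ?_
    funext Y Z q
    change braidNat hi hn (ε + ε') Y Z q = braidNat hi hn ε Y Z q + braidNat hi hn ε' Y Z q
    match q with
    | .nil =>
      simp only [braidNat_nil hi hn h2, halfSum_add]
      refine (colHom_eq_iff hi hn (ψ := natCol₀ i (halfSum ε) Y.pos
        + natCol₀ i (halfSum ε') Y.pos)).2 fun t ht => ?_
      cases t <;> simp only [natCol₀, Pi.add_apply]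
      split_ifs
      · rw [add_zero]
      · ring
    | .cons .nil f =>
      simp only [braidNat_single, halfSum_add]
      refine (colHom_eq_iff hi hn (ψ := natCol₁ i (halfSum ε) Y.pos Z.pos f
        + natCol₁ i (halfSum ε') Y.pos Z.pos f)).2 fun t ht => ?_
      cases t <;> simp only [natCol₁, Pi.add_apply, add_zero]
      split_ifs
      · rw [add_mul, smul_add]
      · rw [add_zero]
    | .cons (.cons _ _) _ => exact (add_zero 0).symm
  map_smul' r ε := by
    refine Subtype.ext ?_
    funext Y Z q
    change braidNat hi hn (r • ε) Y Z q = r • braidNat hi hn ε Y Z q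
    match q with
    | .nil =>
      simp only [braidNat_nil hi hn h2, halfSum_smul]
      refine (colHom_eq_iff hi hn (ψ := r • natCol₀ i (halfSum ε) Y.pos)).2 fun t ht => ?_
      cases t <;> simp only [natCol₀, Pi.smul_apply]
      split_ifs
      · rw [smul_zero]
      · rw [← smul_add, mul_smul_comm]
    | .cons .nil f =>
      simp only [braidNat_single, halfSum_smul]
      refine (colHom_eq_iff hi hn (ψ := r • natCol₁ i (halfSum ε) Y.pos Z.pos f)).2 fun t ht => ?_
      cases t <;> simp only [natCol₁, Pi.smul_apply, smul_zero]
      split_ifs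
      · rw [smul_mul_assoc, smul_comm]
      · rw [smul_zero]
    | .cons (.cons _ _) _ => exact (smul_zero r).symm

theorem braidNatTrans_left_add_right (h2 : (2 : k) ≠ 0) (ε : ℕ+ →₀ k) {Y : KLRW k n}
    (hY : Y.pos = i) :
    col hi hn ((braidNatTrans hi hn h2 ε).1 Y Y .nil) .left
      + col hi hn ((braidNatTrans hi hn h2 ε).1 Y Y .nil) .right
      = (2 : k) • halfSum ε := by
  change col hi hn (braidNat hi hn ε Y Y .nil) .left + col hi hn (braidNat hi hn ε Y Y .nil) .right
    = _
  rw [braidNat_nil hi hn h2, col_colHom _ (Or.inr hY), col_colHom _ (Or.inr hY), two_smul]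
  rfl

variable (hi hn) in
-- Both halves rest on the invariant `L + R`, which equals `2 • halfSum ε` on `η_ε`.
theorem braidNatTrans_bijective (h2 : (2 : k) ≠ 0) :
    Function.Bijective ((Submodule.mkQ ((coboundaries (incl k (KLRW k n)) (braidFunctor hi hn)
      0).submoduleOf (natTrans _ _ 0))) ∘ₗ braidNatTrans hi hn h2) := by
  obtain ⟨T, hT⟩ := KLRW.exists_pos_eq (k := k) hn
  constructor
  · refine (injective_iff_map_eq_zero _).2 fun ε hε => ?_
    have h0 := (Submodule.Quotient.mk_eq_zero ((coboundaries (incl k (KLRW k n))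
      (braidFunctor hi hn) 0).submoduleOf (natTrans _ _ 0))).1 hε
    have h := col_add_col_of_mem_coboundaries h0 hT
    have h' := (braidNatTrans_left_add_right h2 ε hT).symm.trans h
    exact eq_zero_of_halfSum_eq_zero h2 ((smul_eq_zero.1 h').resolve_left h2)
  · intro x
    obtain ⟨η, rfl⟩ := Submodule.Quotient.mk_surjective _ x
    -- With `halfSum ε = (L + R) / 2`, the difference `η_ε - η` has invariant zero.
    obtain ⟨ε, hε⟩ := exists_halfSum_eq h2 ((2 : k)⁻¹ •
      (col hi hn (η.1 T T .nil) .left + col hi hn (η.1 T T .nil) .right))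
    refine ⟨ε, (Submodule.Quotient.eq _).2 (mem_coboundaries
      (braidNatTrans hi hn h2 ε - η).2 fun Y hY => ?_)⟩
    obtain rfl : Y = T := KLRW.pos_injective (hY.trans hT.symm)
    have h := braidNatTrans_left_add_right (hi := hi) (hn := hn) h2 ε hT
    rw [hε, smul_inv_smul₀ h2] at h
    have h' : ∀ t, (t = .main ∨ Y.pos = i) →
        col hi hn ((braidNatTrans hi hn h2 ε - η).1 Y Y .nil) t
          = col hi hn ((braidNatTrans hi hn h2 ε).1 Y Y .nil) t - col hi hn (η.1 Y Y .nil) t := by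
      intro t ht
      rw [col_apply _ _ _ ht, col_apply _ _ _ ht, col_apply _ _ _ ht]
      rfl
    rw [Submodule.subtype_apply, h' _ (Or.inr hT), h' _ (Or.inr hT)]
    linear_combination h

variable (hi hn) in
theorem exists_braidNat_single_ne_zero (h2 : (2 : k) ≠ 0) {ε : ℕ+ →₀ k} (hε : ε ≠ 0) :
    ∃ (Y Z : KLRW k n) (f : Y ⟶ Z), braidNat hi hn ε Y Z (.cons .nil f) ≠ 0 := by
  obtain ⟨T, hT⟩ := KLRW.exists_pos_eq (k := k) hn
  -- Since `0 < i`, the object `T_0` lies to the left of `T_i`; the sign is `1` and `η¹(a_{i0}s⁰)`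
  -- is `halfSum ε` itself.
  let f : (⟨0⟩ : KLRW k n) ⟶ T := (1 : k[X])
  refine ⟨⟨0⟩, T, f, fun h => hε (eq_zero_of_halfSum_eq_zero h2 ?_)⟩
  rw [braidNat_single] at h
  have h' := (colHom_eq_iff hi hn (ψ := 0)).1 h .main (Or.inl rfl)
  have hs : ((i : ℤ) - (⟨0⟩ : KLRW k n).pos).sign = 1 :=
    Int.sign_eq_one_of_pos (by simp [KLRW.pos]; omega)
  simpa [natCol₁, hT, hs, f] using h'

end BraidNat

end Braid

theorem mainTheorem7 {k : Type*} [Field k] (h2 : (2 : k) ≠ 0) (n i : ℕ) (hi : 0 < i) (hn : i < n) :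
    ∃ Φ : (ℕ+ →₀ k) ≃ₗ[k]
        Braid.HH (Braid.incl k (Braid.KLRW k n)) (Braid.braidFunctor hi hn) 0,
      (∀ ε : ℕ+ →₀ k,
        ∃ η : Braid.natTrans (Braid.incl k (Braid.KLRW k n)) (Braid.braidFunctor (k := k) hi hn) 0,
          η.1 = Braid.braidNat hi hn ε ∧ Φ ε = Submodule.Quotient.mk η) ∧
      ∀ ε : ℕ+ →₀ k, ε ≠ 0 →
        ∃ (Y Z : Braid.KLRW k n) (f : Y ⟶ Z),
          Braid.braidNat hi hn ε Y Z (Quiver.Path.cons .nil f) ≠ 0 :=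
  ⟨.ofBijective _ (Braid.braidNatTrans_bijective hi hn h2),
    fun ε => ⟨Braid.braidNatTrans hi hn h2 ε, rfl, rfl⟩,
    fun _ => Braid.exists_braidNat_single_ne_zero hi hn h2⟩
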